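/- **Theorem (Finite Propagation).** *Setting.* Let $\alpha>0$, $0<\sigma<\min(3/\alpha,2)$ and $\delta=3/\alpha-\sigma$. Let $\overline T>0$ and let $A:\mathbb R\to \mathrm{GL}^+(3)$ be a solution of $$A''=\overline T\,(\det A(0))^{1/\alpha}(\det A)^{-1/\alpha}A^{-\top}$$ such that $c_1(1+t^3)\le\det A(t)\le c_2(1+t^3)$ for all $t\ge0$, with constants $0<c_1\le c_2$. Put $\mu=(\det A)^{1/3}$, $O=\mu^{-1}A$, $\Lambda=(\det A)^{2/3}A^{-1}A^{-\top}$, $\overline C=\overline T(\det A(0))^{1/\alpha}$, regarded as functions of the rescaled time $\tau$ given by $d\tau/dt=1/\mu$, $\tau(0)=0$, and put $\Gamma^*=O^{-1}\partial_\tau O$. Let $w(y)=e^{-|y|^2/2}$ on $\mathbb R^3$. For a vector field $\theta$ on $\mathbb R^3$ put $\eta(y)=y+\theta(y)$, $\mathscr A=[D\eta]^{-1}$, $\mathscr J=\det D\eta$, $[\nabla_\eta F]^i_r=\mathscr A^s_rF^i_{,s}$ and $\mathrm{div}_\eta F=\mathscr A^s_\ell F^\ell_{,s}$ (repeated indices are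 summed). Write $\|\cdot\|$ for the norm of $L^2(\mathbb R^3)$. Let $N\ge4$, $\lambda>0$, $T^*>0$, and let $\beta:\mathbb R^3\to\mathbb R$ be a $C^1$ function with $\|\beta\|^2_{H^{N+1}(\mathbb R^3)}\le\lambda$ and support in the closed unit ball. Let $\theta,V:[0,T^*]\times\mathbb R^3\to\mathbb R^3$ be a classical ($\theta\in C^2$) solution of $V=\partial_\tau\theta$ and, for $i=1,2,3$, $$\mu^\sigma\partial_{\tau\tau}\theta_i+\mu_\tau\mu^{-1+\sigma}\partial_\tau\theta_i+2\mu^\sigma\Gamma^*_{ij}\partial_\tau\theta_j+\overline C\mu^{-\delta}\Lambda_{i\ell}\theta_\ell+\frac{\overline C\mu^{-\delta}}{w}\Big(w\Lambda_{ij}(1+\beta)\big(\mathscr A^k_j\mathscr J^{-1/\alpha}-\delta^k_j\big)\Big)_{,k}+\frac{\overline C\mu^{-\delta}}{w}\Lambda_{ik}(w\beta)_{,k}=0,$$ such that $\theta(0,\cdot)$ and $V(0,\cdot)$ are supported in the closed unit ball. Assume that, with some constant $C$, for all $\tau\in[0,T^*]$, $$\|\mathscr A-\mathrm{Id}\|_{L^\infty}<\tfrac13,\quad\|D\theta\|_{L^\infty}<\tfrac13,\quad\|\mathscr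 J-1\|_{L^\infty}<\tfrac13,\quad\mathcal S^N(\tau)<\tfrac13,\quad\|DV\|_{L^\infty}\le C,\quad\|D\,\partial_\tau V\|_{L^\infty}\le C$$ (the derivative $D\,\partial_\tau V$ existing pointwise; the matrix norm is the maximum of the absolute values of the entries), where, with weak derivatives $\partial^\nu$ in $y$, $$\mathcal S^N(\tau)=\sup_{0\le\tau'\le\tau}\Big\{\sum_{|\nu|\le N}\big(\mu^\sigma\|\partial^\nu V\|^2+\|\partial^\nu\theta\|^2\big)+\sum_{|\nu|\le N-1}\big(\|\nabla_\eta\partial^\nu\theta\|^2+\|\mathrm{div}_\eta\partial^\nu\theta\|^2\big)+\sum_{|\nu|=N}\mu^{-\delta}\big(\|\nabla_\eta\partial^\nu\theta\|^2+\|\mathrm{div}_\eta\partial^\nu\theta\|^2\big)\Big\}.$$ *Conclusion.* There is $K>0$ such that $\theta(\tau,y)=V(\tau,y)=0$ for all $\tau\in[0,T^*]$ and all $y\in\mathbb R^3$ with $|y|>1+K\tau$. -/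

import Mathlib

open MeasureTheory Set
open scoped ENNReal ContDiff

noncomputable section

namespace FiniteProp

/-- Physical space `ℝ³` with the Euclidean norm. -/
abbrev E3 : Type := EuclideanSpace ℝ (Fin 3)

/-- Real `3 × 3` matrices. -/
abbrev M3 : Type := Matrix (Fin 3) (Fin 3) ℝ

/-! ### Spatial derivatives -/

/-- The classical partial derivative `∂_i f` of a scalar function. -/
def pderiv (i : Fin 3) (f : E3 → ℝ) : E3 → ℝ :=
  fun y => fderiv ℝ f y (EuclideanSpace.single i (1 : ℝ))

/-- The classical derivative `∂^ν f = ∂₁^{ν₁} ∂₂^{ν₂} ∂₃^{ν₃} f`. -/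
def mpderiv (ν : Fin 3 → ℕ) (f : E3 → ℝ) : E3 → ℝ :=
  (pderiv 0)^[ν 0] ((pderiv 1)^[ν 1] ((pderiv 2)^[ν 2] f))

/-- The Jacobian matrix `[DF]^i_j = F^i,_j` of a vector field. -/
def jac (F : E3 → E3) (y : E3) : M3 :=
  Matrix.of fun i j => pderiv j (fun x => F x i) y

/-- `g` is the weak (distributional) derivative `∂^ν f` of `f`. -/
def HasWeakPartial (ν : Fin 3 → ℕ) (f g : E3 → ℝ) : Prop :=
  LocallyIntegrable f ∧ LocallyIntegrable g ∧
    ∀ φ : E3 → ℝ, ContDiff ℝ ∞ φ → HasCompactSupport φ →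
      ∫ y, f y * mpderiv ν φ y = (-1 : ℝ) ^ (∑ i, ν i) * ∫ y, g y * φ y

open Classical in
/-- The weak derivative `∂^ν f` (determined up to a null set, and `0` if there is none). -/
def weakPartial (ν : Fin 3 → ℕ) (f : E3 → ℝ) : E3 → ℝ :=
  if h : ∃ g, HasWeakPartial ν f g then h.choose else 0

/-- All weak derivatives of `f` of order at most `k` exist as locally integrable functions. -/
def HasWeakPartials (k : ℕ) (f : E3 → ℝ) : Prop :=
  ∀ ν : Fin 3 → ℕ, ∑ i, ν i ≤ k → ∃ g, HasWeakPartial ν f g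

/-- The squared norm `‖f‖²` in `L²(ℝ³)`, as an extended nonnegative real. -/
def L2sq (f : E3 → ℝ) : ℝ≥0∞ := ∫⁻ y, ENNReal.ofReal (f y ^ 2)

/-- The finite set of multi-indices `ν ∈ ℕ³` with `|ν| = m`. -/
def multiIdx (m : ℕ) : Finset (Fin 3 → ℕ) := Finset.Nat.antidiagonalTuple 3 m

open Classical in
/-- The squared Sobolev norm `‖f‖²_{H^k(ℝ³)} = ∑_{|ν| ≤ k} ‖∂^ν f‖²`; it is `∞` if `f ∉ H^k`. -/
def sobolevSq (k : ℕ) (f : E3 → ℝ) : ℝ≥0∞ :=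
  if HasWeakPartials k f then
    ∑ m ∈ Finset.range (k + 1), ∑ ν ∈ multiIdx m, L2sq (weakPartial ν f)
  else ⊤

/-- The `L^∞(ℝ³)` norm of a matrix field, with respect to the maximum norm on matrices. -/
def matLinf (M : E3 → M3) : ℝ≥0∞ :=
  ⨆ i, ⨆ j, eLpNorm (fun y => M y i j) ⊤ volume

/-! ### The background affine motion -/

/-- An isothermal affine motion `x = A(t) y` expanding linearly in each coordinate direction:
`A'' = T̄ (det A(0))^{1/α} (det A)^{-1/α} A^{-⊤}` with `A(t) ∈ GL⁺(3)` and
`det A(t) ∼ 1 + t³` for `t ≥ 0`. -/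
structure AffineMotion (α : ℝ) where
  /-- the constant initial temperature -/
  Tbar : ℝ
  Tbar_pos : 0 < Tbar
  /-- the deformation matrix -/
  A : ℝ → M3
  /-- its time derivative -/
  A' : ℝ → M3
  det_pos : ∀ t, 0 < (A t).det
  hasDeriv_A : ∀ t i j, HasDerivAt (fun s => A s i j) (A' t i j) t
  hasDeriv_A' : ∀ t i j, HasDerivAt (fun s => A' s i j)
    (Tbar * (A 0).det ^ (1 / α) * (A t).det ^ (-(1 / α)) * ((A t)⁻¹).transpose i j) t
  det_growth : ∃ c₁ c₂ : ℝ, 0 < c₁ ∧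
    ∀ t, 0 ≤ t → c₁ * (1 + t ^ 3) ≤ (A t).det ∧ (A t).det ≤ c₂ * (1 + t ^ 3)

namespace AffineMotion

variable {α : ℝ} (B : AffineMotion α)

/-- `μ = (det A)^{1/3}` as a function of the time `t`. -/
def muT (t : ℝ) : ℝ := (B.A t).det ^ ((1 : ℝ) / 3)

/-- The rescaled time `τ(t)`, given by `dτ/dt = 1/μ` and `τ(0) = 0`. -/
def tau (t : ℝ) : ℝ := ∫ s in (0 : ℝ)..t, 1 / B.muT s

/-- The inverse change of time `τ ↦ t(τ)` on `[0, ∞)`. -/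
def time (τ : ℝ) : ℝ := Function.invFunOn B.tau (Ici 0) τ

/-- `A` as a function of `τ`. -/
def Aτ (τ : ℝ) : M3 := B.A (B.time τ)

/-- `μ` as a function of `τ`. -/
def mu (τ : ℝ) : ℝ := B.muT (B.time τ)

/-- `μ_τ = dμ/dτ`. -/
def muDot (τ : ℝ) : ℝ := derivWithin B.mu (Ici 0) τ

/-- `O = μ⁻¹ A ∈ SL(3)` as a function of `τ`. -/
def O (τ : ℝ) : M3 := (B.mu τ)⁻¹ • B.Aτ τ

/-- `O_τ = dO/dτ`. -/
def ODot (τ : ℝ) : M3 := Matrix.of fun i j => derivWithin (fun s => B.O s i j) (Ici 0) τ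

/-- `Γ* = O⁻¹ O_τ`. -/
def Gam (τ : ℝ) : M3 := (B.O τ)⁻¹ * B.ODot τ

/-- `Λ = (det A)^{2/3} A⁻¹ A^{-⊤}` as a function of `τ`. -/
def Lam (τ : ℝ) : M3 :=
  (B.Aτ τ).det ^ ((2 : ℝ) / 3) • ((B.Aτ τ)⁻¹ * ((B.Aτ τ)⁻¹).transpose)

/-- `C̄ = T̄ (det A(0))^{1/α}`. -/
def Cbar : ℝ := B.Tbar * (B.A 0).det ^ (1 / α)

end AffineMotion

/-! ### The perturbation equation -/

/-- The Gaussian `w(y) = e^{-|y|²/2}`. -/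
def w (y : E3) : ℝ := Real.exp (-(‖y‖ ^ 2 / 2))

/-- The Jacobian matrix `Dη` of the flow map `η(y) = y + θ(y)`. -/
def Deta (θ : E3 → E3) (y : E3) : M3 := jac (fun x => x + θ x) y

/-- `𝒜 = [Dη]⁻¹`; the entry `𝒜^k_j` is `scrA θ y k j`. -/
def scrA (θ : E3 → E3) (y : E3) : M3 := (Deta θ y)⁻¹

/-- `𝒥 = det [Dη]`. -/
def scrJ (θ : E3 → E3) (y : E3) : ℝ := (Deta θ y).det

/-- The time derivative at `τ`, on the interval `[0, T]`, of a time dependent vector field. -/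
def dtime (T : ℝ) (V : ℝ → E3 → E3) (τ : ℝ) (y : E3) : E3 :=
  derivWithin (fun s => V s y) (Icc 0 T) τ

/-- `(θ, V)` is a classical solution on `[0, T] × ℝ³` of `V = ∂_τ θ` and, with `δ = 3/α - σ`,
`μ^σ ∂_ττ θ_i + μ_τ μ^{-1+σ} ∂_τ θ_i + 2 μ^σ Γ*_ij ∂_τ θ_j + C̄ μ^{-δ} Λ_iℓ θ_ℓ
  + (C̄ μ^{-δ} / w) (w Λ_ij (1+β) (𝒜^k_j 𝒥^{-1/α} - δ^k_j)),_k + (C̄ μ^{-δ} / w) Λ_ik (w β),_k = 0`.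
-/
structure IsSolution {α : ℝ} (B : AffineMotion α) (σ : ℝ) (β : E3 → ℝ) (T : ℝ)
    (θ V : ℝ → E3 → E3) : Prop where
  contDiff : ContDiffOn ℝ 2 (fun p : ℝ × E3 => θ p.1 p.2) (Icc 0 T ×ˢ univ)
  velocity : ∀ τ ∈ Icc 0 T, ∀ y, V τ y = dtime T θ τ y
  equation : ∀ τ ∈ Icc 0 T, ∀ y : E3, ∀ i : Fin 3,
    B.mu τ ^ σ * dtime T V τ y i
      + B.muDot τ * B.mu τ ^ (-1 + σ) * V τ y i
      + 2 * B.mu τ ^ σ * ∑ j, B.Gam τ i j * V τ y j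
      + B.Cbar * B.mu τ ^ (-(3 / α - σ)) * ∑ l, B.Lam τ i l * θ τ y l
      + B.Cbar * B.mu τ ^ (-(3 / α - σ)) / w y *
          ∑ k, pderiv k (fun x => ∑ j, w x * B.Lam τ i j * (1 + β x) *
            (scrA (θ τ) x k j * scrJ (θ τ) x ^ (-(1 / α)) - (1 : M3) k j)) y
      + B.Cbar * B.mu τ ^ (-(3 / α - σ)) / w y *
          ∑ k, B.Lam τ i k * pderiv k (fun x => w x * β x) y = 0

/-! ### The high-order norm and the a priori assumptions -/

/-- The weak partial derivative `(∂^ν θ^i),_s = ∂^{ν + e_s} θ^i`. -/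
def dws (ν : Fin 3 → ℕ) (s : Fin 3) (θ : E3 → E3) (i : Fin 3) : E3 → ℝ :=
  weakPartial (ν + Pi.single s 1) (fun y => θ y i)

/-- `‖∂^ν F‖²` for a vector field `F`. -/
def vecSq (ν : Fin 3 → ℕ) (F : E3 → E3) : ℝ≥0∞ :=
  ∑ i, L2sq (weakPartial ν (fun y => F y i))

/-- `‖∇_η ∂^ν θ‖²`, where `[∇_η F]^i_r = 𝒜^s_r F^i,_s`. -/
def gradEtaSq (ν : Fin 3 → ℕ) (θ : E3 → E3) : ℝ≥0∞ :=
  ∑ i, ∑ r, L2sq (fun y => ∑ s, scrA θ y s r * dws ν s θ i y)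

/-- `‖div_η ∂^ν θ‖²`, where `div_η F = 𝒜^s_ℓ F^ℓ,_s`. -/
def divEtaSq (ν : Fin 3 → ℕ) (θ : E3 → E3) : ℝ≥0∞ :=
  L2sq (fun y => ∑ l, ∑ s, scrA θ y s l * dws ν s θ l y)

open Classical in
/-- The expression under the supremum in `𝒮^N`, at one time, for given values `m = μ(τ)`, `σ`
and `δ`; it is `∞` if `V ∉ H^N` or if weak derivatives of `θ` up to order `N + 1` are lacking. -/
def SNslice (N : ℕ) (m σ δ : ℝ) (θ V : E3 → E3) : ℝ≥0∞ :=
  if (∀ i, HasWeakPartials N (fun y => V y i)) ∧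
      (∀ i, HasWeakPartials (N + 1) (fun y => θ y i)) then
    (∑ n ∈ Finset.range (N + 1), ∑ ν ∈ multiIdx n,
        (ENNReal.ofReal (m ^ σ) * vecSq ν V + vecSq ν θ))
      + (∑ n ∈ Finset.range N, ∑ ν ∈ multiIdx n, (gradEtaSq ν θ + divEtaSq ν θ))
      + ∑ ν ∈ multiIdx N, (ENNReal.ofReal (m ^ (-δ)) * gradEtaSq ν θ
          + ENNReal.ofReal (m ^ (-δ)) * divEtaSq ν θ)
  else ⊤

/-- The high-order quantity `𝒮^N(τ)`. -/
def SN {α : ℝ} (B : AffineMotion α) (N : ℕ) (σ : ℝ) (θ V : ℝ → E3 → E3) (τ : ℝ) : ℝ≥0∞ :=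
  ⨆ τ' ∈ Icc 0 τ, SNslice N (B.mu τ') σ (3 / α - σ) (θ τ') (V τ')

/-- The a priori assumptions on `[0, T]` with constant `C`. -/
structure APriori {α : ℝ} (B : AffineMotion α) (N : ℕ) (σ C T : ℝ) (θ V : ℝ → E3 → E3) :
    Prop where
  scrA_bound : ∀ τ ∈ Icc 0 T, matLinf (fun y => scrA (θ τ) y - 1) < ENNReal.ofReal (1 / 3)
  jac_bound : ∀ τ ∈ Icc 0 T, matLinf (jac (θ τ)) < ENNReal.ofReal (1 / 3)
  scrJ_bound : ∀ τ ∈ Icc 0 T,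
    eLpNorm (fun y => scrJ (θ τ) y - 1) ⊤ volume < ENNReal.ofReal (1 / 3)
  SN_bound : ∀ τ ∈ Icc 0 T, SN B N σ θ V τ < ENNReal.ofReal (1 / 3)
  jacV_bound : ∀ τ ∈ Icc 0 T, matLinf (jac (V τ)) ≤ ENNReal.ofReal C
  jacVτ_differentiable : ∀ τ ∈ Icc 0 T, Differentiable ℝ (dtime T V τ)
  jacVτ_bound : ∀ τ ∈ Icc 0 T, matLinf (jac (dtime T V τ)) ≤ ENNReal.ofReal C

end FiniteProp

end

/-! Outside the unit ball $\beta$ vanishes, and there the equation is a quasilinear wave equation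
with the zero solution. Its symmetric hyperbolic form gives a local energy identity, and integration
over backward cones that miss the unit ball shows that nothing enters them.

The form comes from the relative enthalpy $q=-(1+1/\alpha)\log\mathscr J+(|\eta|^2-|y|^2)/2$. By the
Piola identity, pressure force and linear term together equal $\Lambda$ applied to $\mathscr
J^{-1/\alpha}\mathscr A^\top\nabla q+(1-\mathscr J^{-1/\alpha})\eta$ (`exterior_equation`).
Multiplication by a positive multiple of $\Lambda^{-1}$ makes the coefficient $S$ of $\partial_\tau
V$ symmetric and positive definite (`exists_symmetrizer`). In the other direction $\partial_\tau
q=-(1+1/\alpha)\mathscr A^k_l V^l_{,k}+\eta\cdot V$ (`slabD_time_enth`), with the same matrix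
$\mathscr A$.

The energy density $e=\frac12\mathscr J^{1/\alpha}\,V\cdot
SV+\frac{\alpha}{2(1+\alpha)}q^2+\frac12|\theta|^2$ has weights for which all terms with $\nabla q$
and $\nabla V$ combine into minus the divergence of $f^k=q\mathscr A^k_jV^j$, up to lower order
terms (`energy_identity`). The remainder is quadratic in $(V,q,\theta)$ with coefficients bounded on
bounded sets. The one term that is not visibly so contains $\mathscr J^{1/\alpha}-1$, which $q$ and
$\theta$ control linearly (`exists_temperature_bound`). Hence $\partial_\tau
e+\operatorname{div}f\le Me$ locally, where $M$ may depend on the ball.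

The a priori bounds on $\mathscr A$ and $\mathscr J$ make $e$ coercive and give $|v\cdot f|\le
K|v|e$ with $K$ uniform in space. A weight supported in a backward cone of slope $K$ then yields a
Grönwall inequality for the weighted energy (`energy_eq_zero_on_cone`). -/

namespace FiniteProp

/-! ### Calculus of matrix valued functions -/

section MatrixCalculus

variable {E : Type*} [NormedAddCommGroup E] [NormedSpace ℝ E]

lemma contDiffOn_det {n : WithTop ℕ∞} {m : E → M3} {s : Set E}
    (h : ∀ i j, ContDiffOn ℝ n (fun x => m x i j) s) : ContDiffOn ℝ n (fun x => (m x).det) s := by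
  simp only [Matrix.det_fin_three]
  exact ((((((((h 0 0).mul (h 1 1)).mul (h 2 2)).sub (((h 0 0).mul (h 1 2)).mul (h 2 1))).sub
    (((h 0 1).mul (h 1 0)).mul (h 2 2))).add (((h 0 1).mul (h 1 2)).mul (h 2 0))).add
    (((h 0 2).mul (h 1 0)).mul (h 2 1))).sub (((h 0 2).mul (h 1 1)).mul (h 2 0)))

lemma contDiffOn_adjugate {n : WithTop ℕ∞} {m : E → M3} {s : Set E}
    (h : ∀ i j, ContDiffOn ℝ n (fun x => m x i j) s) (i j : Fin 3) :
    ContDiffOn ℝ n (fun x => (m x).adjugate i j) s := by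
  simp only [Matrix.adjugate_apply]
  refine contDiffOn_det fun a b => ?_
  by_cases ha : a = j
  · subst ha
    simp only [Matrix.updateRow_self]
    exact contDiffOn_const
  · simp only [Matrix.updateRow_ne ha]
    exact h a b

lemma contDiffOn_inv {n : WithTop ℕ∞} {m : E → M3} {s : Set E}
    (h : ∀ i j, ContDiffOn ℝ n (fun x => m x i j) s) (hd : ∀ x ∈ s, (m x).det ≠ 0) (i j : Fin 3) :
    ContDiffOn ℝ n (fun x => (m x)⁻¹ i j) s := by
  simp only [Matrix.inv_def, Matrix.smul_apply, Ring.inverse_eq_inv', smul_eq_mul]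
  exact ((contDiffOn_det h).inv hd).mul (contDiffOn_adjugate h i j)

lemma contDiffOn_mul {n : WithTop ℕ∞} {m₁ m₂ : E → M3} {s : Set E}
    (h₁ : ∀ i j, ContDiffOn ℝ n (fun x => m₁ x i j) s)
    (h₂ : ∀ i j, ContDiffOn ℝ n (fun x => m₂ x i j) s) (i j : Fin 3) :
    ContDiffOn ℝ n (fun x => (m₁ x * m₂ x) i j) s := by
  simp only [Matrix.mul_apply]
  exact ContDiffOn.sum fun k _ => (h₁ i k).mul (h₂ k j)

/-- Derivative of the entries of the inverse of a curve of matrices. -/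
lemma hasDerivAt_inv {m : ℝ → M3} {m' : M3} {t : ℝ}
    (h : ∀ i j, HasDerivAt (fun s => m s i j) (m' i j) t) (hd : (m t).det ≠ 0) (i j : Fin 3) :
    HasDerivAt (fun s => (m s)⁻¹ i j) (-((m t)⁻¹ * m' * (m t)⁻¹) i j) t := by
  have hdet : DifferentiableAt ℝ (fun s => (m s).det) t := by
    simp only [Matrix.det_fin_three]
    have := fun i j => (h i j).differentiableAt
    fun_prop
  have hadj : ∀ i j, DifferentiableAt ℝ (fun s => (m s).adjugate i j) t := by
    intro i j
    have := fun i j => (h i j).differentiableAt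
    simp only [Matrix.adjugate_fin_three]
    fin_cases i <;> fin_cases j <;> simp <;> fun_prop
  have hinv : ∀ i j, DifferentiableAt ℝ (fun s => (m s)⁻¹ i j) t := by
    intro i j
    simp only [Matrix.inv_def, Matrix.smul_apply, Ring.inverse_eq_inv', smul_eq_mul]
    exact (hdet.inv hd).mul (hadj i j)
  set D : M3 := Matrix.of fun i j => deriv (fun s => (m s)⁻¹ i j) t with hD
  have hu : IsUnit (m t).det := isUnit_iff_ne_zero.2 hd
  -- The cofactor formula gives differentiability only. The value of the derivative comes from
  -- differentiating $m^{-1}m=1$, which holds near $t$ because the determinant stays nonzero there.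
  have key : D * m t + (m t)⁻¹ * m' = 0 := by
    ext a b
    have h1 : HasDerivAt (fun s => ∑ k, (m s)⁻¹ a k * m s k b)
        (∑ k, (D a k * m t k b + (m t)⁻¹ a k * m' k b)) t :=
      HasDerivAt.fun_sum fun k _ => (hinv a k).hasDerivAt.mul (h k b)
    have h2 : (fun s => ∑ k, (m s)⁻¹ a k * m s k b) =ᶠ[nhds t] fun _ => (1 : M3) a b := by
      filter_upwards [hdet.continuousAt.eventually_ne hd] with s hs
      rw [← Matrix.mul_apply, Matrix.nonsing_inv_mul _ (isUnit_iff_ne_zero.2 hs)]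
    have h3 := (h1.congr_of_eventuallyEq h2.symm).unique (hasDerivAt_const t _)
    simpa [Matrix.add_apply, Matrix.mul_apply, Finset.sum_add_distrib] using h3
  have : D = -((m t)⁻¹ * m' * (m t)⁻¹) := by
    have h4 := congrArg (· * (m t)⁻¹) key
    simp only [add_mul, zero_mul] at h4
    rw [Matrix.mul_nonsing_inv_cancel_right _ _ hu] at h4
    exact eq_neg_of_add_eq_zero_left h4
  have h5 := (hinv i j).hasDerivAt
  have h6 : deriv (fun s => (m s)⁻¹ i j) t = -((m t)⁻¹ * m' * (m t)⁻¹) i j := by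
    rw [← Matrix.neg_apply, ← this]; rfl
  rwa [h6] at h5

/-- Jacobi's formula for the logarithm of the determinant. -/
lemma hasDerivAt_log_det {m : ℝ → M3} {m' : M3} {t : ℝ}
    (h : ∀ i j, HasDerivAt (fun s => m s i j) (m' i j) t) (hd : (m t).det ≠ 0) :
    HasDerivAt (fun s => Real.log (m s).det) (∑ k, ∑ l, (m t)⁻¹ k l * m' l k) t := by
  have h1 := (((((((h 0 0).mul (h 1 1)).mul (h 2 2)).sub (((h 0 0).mul (h 1 2)).mul (h 2 1))).sub
    (((h 0 1).mul (h 1 0)).mul (h 2 2))).add (((h 0 1).mul (h 1 2)).mul (h 2 0))).add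
    (((h 0 2).mul (h 1 0)).mul (h 2 1))).sub (((h 0 2).mul (h 1 1)).mul (h 2 0))
  have h2 : HasDerivAt (fun s => (m s).det) _ t :=
    h1.congr_of_eventuallyEq (Filter.Eventually.of_forall fun s => by
      simp [Matrix.det_fin_three])
  convert h2.log hd using 1
  simp only [Matrix.inv_def, Matrix.smul_apply, Ring.inverse_eq_inv', smul_eq_mul,
    Matrix.adjugate_fin_three, Fin.sum_univ_three]
  rw [eq_div_iff hd]
  field_simp
  simp
  ring

end MatrixCalculus

/-! ### Energy estimates on backward cones -/

section Slab

variable {F : Type*} [NormedAddCommGroup F] [NormedSpace ℝ F] {T : ℝ}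

/-- The space-time slab `[0, T] × ℝ³`. -/
def slab (T : ℝ) : Set (ℝ × E3) := Icc 0 T ×ˢ univ

lemma mem_slab {p : ℝ × E3} : p ∈ slab T ↔ p.1 ∈ Icc 0 T := by simp [slab]

/-- The solution lives on a closed time interval. Unique differentiability gives derivatives within
the slab a meaning up to both time faces. -/
lemma uniqueDiffOn_slab (hT : 0 < T) : UniqueDiffOn ℝ (slab T) :=
  (uniqueDiffOn_Icc hT).prod uniqueDiffOn_univ

lemma continuousOn_fderivWithin_slab (hT : 0 < T) {g : ℝ × E3 → F}
    (hg : ContDiffOn ℝ 1 g (slab T)) : ContinuousOn (fderivWithin ℝ g (slab T)) (slab T) :=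
  hg.continuousOn_fderivWithin (uniqueDiffOn_slab hT) le_rfl

lemma contDiff_slice {n : WithTop ℕ∞} {g : ℝ × E3 → F}
    (hg : ContDiffOn ℝ n g (slab T)) {τ : ℝ} (hτ : τ ∈ Icc 0 T) :
    ContDiff ℝ n (fun y => g (τ, y)) := by
  rw [← contDiffOn_univ]
  exact hg.comp (f := fun y : E3 => (τ, y)) (contDiffOn_const.prodMk contDiffOn_id)
    fun y _ => mem_slab.2 hτ

lemma hasFDerivAt_slice {g : ℝ × E3 → F} (hg : ContDiffOn ℝ 1 g (slab T)) {τ : ℝ}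
    (hτ : τ ∈ Icc 0 T) (y : E3) :
    HasFDerivAt (fun y => g (τ, y))
      ((fderivWithin ℝ g (slab T) (τ, y)).comp (ContinuousLinearMap.inr ℝ ℝ E3)) y := by
  have h1 := (hg.differentiableOn one_ne_zero (τ, y) (mem_slab.2 hτ)).hasFDerivWithinAt
  rw [← hasFDerivWithinAt_univ]
  exact h1.comp y (hasFDerivAt_prodMk_right τ y).hasFDerivWithinAt fun y _ => mem_slab.2 hτ

lemma fderiv_slice {g : ℝ × E3 → F} (hg : ContDiffOn ℝ 1 g (slab T)) {τ : ℝ}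
    (hτ : τ ∈ Icc 0 T) (y v : E3) :
    fderiv ℝ (fun y => g (τ, y)) y v = fderivWithin ℝ g (slab T) (τ, y) (0, v) := by
  rw [(hasFDerivAt_slice hg hτ y).fderiv]; simp

lemma hasDerivWithinAt_slice {g : ℝ × E3 → F} (hg : ContDiffOn ℝ 1 g (slab T)) {τ : ℝ}
    (hτ : τ ∈ Icc 0 T) (y : E3) :
    HasDerivWithinAt (fun t => g (t, y)) (fderivWithin ℝ g (slab T) (τ, y) (1, 0)) (Icc 0 T) τ := by
  have h1 := (hg.differentiableOn one_ne_zero (τ, y) (mem_slab.2 hτ)).hasFDerivWithinAt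
  have hmaps : MapsTo (fun t : ℝ => (t, y)) (Icc 0 T) (slab T) := fun t ht => mem_slab.2 ht
  have h2 := h1.comp τ (hasFDerivAt_prodMk_left τ y).hasFDerivWithinAt hmaps
  simpa [Function.comp_def] using h2.hasDerivWithinAt

lemma hasDerivAt_slice {g : ℝ × E3 → F} (hg : ContDiffOn ℝ 1 g (slab T)) {τ : ℝ}
    (hτ : τ ∈ Ioo 0 T) (y : E3) :
    HasDerivAt (fun t => g (t, y)) (fderivWithin ℝ g (slab T) (τ, y) (1, 0)) τ :=
  (hasDerivWithinAt_slice hg (Ioo_subset_Icc_self hτ) y).hasDerivAt (Icc_mem_nhds hτ.1 hτ.2)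

/-- A continuous function on the slab is bounded on compact sets. -/
lemma exists_bound_slab {F : Type*} [NormedAddCommGroup F] {g : ℝ × E3 → F}
    (hg : ContinuousOn g (slab T)) (y₀ : E3) (R : ℝ) :
    ∃ M, 0 ≤ M ∧ ∀ τ ∈ Icc 0 T, ∀ y ∈ Metric.closedBall y₀ R, ‖g (τ, y)‖ ≤ M := by
  obtain ⟨M, hM⟩ := ((isCompact_Icc (a := (0 : ℝ)) (b := T)).prod
    (isCompact_closedBall y₀ R)).exists_bound_of_continuousOn
      (hg.mono (prod_mono_right (subset_univ _)))
  exact ⟨max M 0, le_max_right _ _, fun τ hτ y hy => (hM (τ, y) ⟨hτ, hy⟩).trans (le_max_left _ _)⟩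

/-- Differentiation of the spatial integral of a compactly supported function. -/
lemma hasDerivAt_integral_slab (hT : 0 < T) {g : ℝ × E3 → ℝ} (hg : ContDiffOn ℝ 1 g (slab T))
    {y₀ : E3} {R : ℝ} (hsupp : ∀ τ ∈ Icc 0 T, ∀ y ∉ Metric.closedBall y₀ R, g (τ, y) = 0)
    {τ : ℝ} (hτ : τ ∈ Ioo 0 T) :
    HasDerivAt (fun t => ∫ y, g (t, y))
      (∫ y, fderivWithin ℝ g (slab T) (τ, y) (1, 0)) τ := by
  have hcont : ContinuousOn (fun p => fderivWithin ℝ g (slab T) p (1, 0)) (slab T) :=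
    (continuousOn_fderivWithin_slab hT hg).clm_apply continuousOn_const
  obtain ⟨M, hM0, hM⟩ := exists_bound_slab hcont y₀ R
  have hint : ∀ t ∈ Icc 0 T, Integrable (fun y => g (t, y)) := fun t ht =>
    (contDiff_slice hg ht).continuous.integrable_of_hasCompactSupport
      (HasCompactSupport.intro (isCompact_closedBall y₀ R) (hsupp t ht))
  refine (hasDerivAt_integral_of_dominated_loc_of_deriv_le (μ := volume) (s := Ioo 0 T)
    (F := fun t y => g (t, y)) (F' := fun t y => fderivWithin ℝ g (slab T) (t, y) (1, 0))
    (bound := (Metric.closedBall y₀ R).indicator fun _ => M) (Ioo_mem_nhds hτ.1 hτ.2)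
    ?_ (hint τ (Ioo_subset_Icc_self hτ)) ?_ ?_ ?_ ?_).2
  · filter_upwards [Ioo_mem_nhds hτ.1 hτ.2] with t ht
    exact (hint t (Ioo_subset_Icc_self ht)).aestronglyMeasurable
  · refine Continuous.aestronglyMeasurable ?_
    have := hcont.comp (f := fun y : E3 => (τ, y)) (s := univ) (by fun_prop)
      fun y _ => mem_slab.2 (Ioo_subset_Icc_self hτ)
    exact continuousOn_univ.1 this
  · refine Filter.Eventually.of_forall fun y t ht => ?_
    by_cases hy : y ∈ Metric.closedBall y₀ R
    · rw [indicator_of_mem hy]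
      exact hM t (Ioo_subset_Icc_self ht) y hy
    -- Outside the ball the function vanishes at all nearby times, so its time derivative vanishes
    -- as well and zero is an admissible bound.
    · rw [indicator_of_notMem hy, norm_le_zero_iff, ← (hasDerivAt_slice hg ht y).deriv]
      have : (fun s => g (s, y)) =ᶠ[nhds t] fun _ => 0 := by
        filter_upwards [Ioo_mem_nhds ht.1 ht.2] with s hs
        exact hsupp s (Ioo_subset_Icc_self hs) y hy
      rw [this.deriv_eq, deriv_const]
  · exact (integrable_indicator_iff measurableSet_closedBall).2
      (integrableOn_const (measure_closedBall_lt_top.ne))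
  · exact Filter.Eventually.of_forall fun y t ht => hasDerivAt_slice hg ht y

end Slab

/-! ### The cone weight and the domain of dependence -/

section Energy

/-- Squaring the positive part removes its kink; this is what makes the cone weight $C^1$. -/
lemma hasDerivAt_max_sq (x : ℝ) : HasDerivAt (fun x : ℝ => max x 0 ^ 2) (2 * max x 0) x := by
  rcases lt_trichotomy x 0 with h | h | h
  · have : (fun x : ℝ => max x 0 ^ 2) =ᶠ[nhds x] fun _ => 0 := by
      filter_upwards [gt_mem_nhds h] with z hz
      simp [max_eq_right hz.le]
    rw [max_eq_right h.le, mul_zero]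
    exact (hasDerivAt_const x 0).congr_of_eventuallyEq this
  · subst h
    rw [hasDerivAt_iff_isLittleO_nhds_zero]
    simp only [zero_add, max_self, mul_zero, smul_zero, sub_zero, ne_eq, OfNat.ofNat_ne_zero,
      not_false_eq_true, zero_pow]
    have h1 : (fun h : ℝ => max h 0 ^ 2) =O[nhds 0] fun h => h ^ 2 := by
      refine Asymptotics.IsBigO.of_bound 1 (Filter.Eventually.of_forall fun z => ?_)
      rw [one_mul, norm_pow, norm_pow]
      gcongr
      rw [Real.norm_eq_abs, Real.norm_eq_abs, abs_of_nonneg (le_max_right _ _)]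
      exact max_le (le_abs_self z) (abs_nonneg z)
    exact h1.trans_isLittleO (Asymptotics.isLittleO_pow_id one_lt_two)
  · have : (fun x : ℝ => max x 0 ^ 2) =ᶠ[nhds x] fun z => z ^ 2 := by
      filter_upwards [lt_mem_nhds h] with z hz
      simp [max_eq_left hz.le]
    rw [max_eq_left h.le]
    simpa using (hasDerivAt_pow 2 x).congr_of_eventuallyEq this

lemma contDiff_max_sq : ContDiff ℝ 1 (fun x : ℝ => max x 0 ^ 2) := by
  rw [contDiff_one_iff_deriv]
  refine ⟨fun x => (hasDerivAt_max_sq x).differentiableAt, ?_⟩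
  rw [funext fun x => (hasDerivAt_max_sq x).deriv]
  fun_prop

/-- The weight supported in the backward cone with base the ball of radius `r` around `y₀`. -/
noncomputable def coneWeight (r K : ℝ) (y₀ : E3) (p : ℝ × E3) : ℝ :=
  max ((r - K * p.1) ^ 2 - ‖p.2 - y₀‖ ^ 2) 0 ^ 2

variable {r K : ℝ} {y₀ : E3}

lemma contDiff_coneWeight : ContDiff ℝ 1 (coneWeight r K y₀) := by
  unfold coneWeight
  refine contDiff_max_sq.comp (f := fun p : ℝ × E3 => (r - K * p.1) ^ 2 - ‖p.2 - y₀‖ ^ 2) ?_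
  refine ContDiff.sub (by fun_prop) ?_
  exact (contDiff_snd.sub contDiff_const).norm_sq ℝ

lemma coneWeight_nonneg (p : ℝ × E3) : 0 ≤ coneWeight r K y₀ p := by
  unfold coneWeight; positivity

lemma hasDerivAt_coneWeight_time (τ : ℝ) (y : E3) :
    HasDerivAt (fun t => coneWeight r K y₀ (t, y))
      (-(4 * K * (r - K * τ) * max ((r - K * τ) ^ 2 - ‖y - y₀‖ ^ 2) 0)) τ := by
  unfold coneWeight
  have h1 : HasDerivAt (fun t : ℝ => (r - K * t) ^ 2 - ‖y - y₀‖ ^ 2)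
      (2 * (r - K * τ) * (-K)) τ := by
    have h : HasDerivAt (fun t : ℝ => r - K * t) (-K) τ := by
      simpa using ((hasDerivAt_id τ).const_mul K).const_sub r
    simpa using (h.pow 2).sub_const (‖y - y₀‖ ^ 2)
  have := (hasDerivAt_max_sq ((r - K * τ) ^ 2 - ‖y - y₀‖ ^ 2)).comp τ h1
  refine this.congr_deriv ?_
  generalize max ((r - K * τ) ^ 2 - ‖y - y₀‖ ^ 2) 0 = g
  ring

/-- With $m$ the positive part, $\partial_\tau\varphi=-4K(r-K\tau)m$ and $\nabla\varphi=-4m(y-y_0)$.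
As $|y-y_0|\le r-K\tau$ wherever $m\ne0$, this gives $\partial_\tau\varphi\le-K|\nabla\varphi|$: the
weight decreases fast enough to absorb any flux of speed $K$. -/
lemma fderiv_coneWeight_space (τ : ℝ) (y v : E3) :
    fderiv ℝ (fun x => coneWeight r K y₀ (τ, x)) y v
      = -(4 * max ((r - K * τ) ^ 2 - ‖y - y₀‖ ^ 2) 0 * inner ℝ (y - y₀) v) := by
  unfold coneWeight
  have h1 : HasFDerivAt (fun x : E3 => (r - K * τ) ^ 2 - ‖x - y₀‖ ^ 2)
      (-(2 • (innerSL ℝ (y - y₀)).comp (ContinuousLinearMap.id ℝ E3))) y :=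
    (((hasFDerivAt_id y).sub_const y₀).norm_sq).const_sub _
  have := (hasDerivAt_max_sq ((r - K * τ) ^ 2 - ‖y - y₀‖ ^ 2)).comp_hasFDerivAt y h1
  rw [HasFDerivAt.fderiv (f := fun x : E3 => max ((r - K * τ) ^ 2 - ‖x - y₀‖ ^ 2) 0 ^ 2) this]
  generalize max ((r - K * τ) ^ 2 - ‖y - y₀‖ ^ 2) 0 = g
  change 2 * g * -(2 • inner ℝ (y - y₀) v) = _
  generalize inner ℝ (y - y₀) v = z
  rw [two_smul]
  ring

lemma coneWeight_eq_zero {τ : ℝ} {y : E3} (h0 : 0 ≤ r - K * τ)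
    (hy : y ∉ Metric.ball y₀ (r - K * τ)) : coneWeight r K y₀ (τ, y) = 0 := by
  have : r - K * τ ≤ ‖y - y₀‖ := by simpa [dist_eq_norm] using hy
  have h2 : (r - K * τ) ^ 2 ≤ ‖y - y₀‖ ^ 2 := by gcongr
  simp [coneWeight, max_eq_right (sub_nonpos.2 h2)]

lemma coneWeight_pos {τ : ℝ} {y : E3} (hy : ‖y - y₀‖ < r - K * τ) :
    0 < coneWeight r K y₀ (τ, y) := by
  have h2 : ‖y - y₀‖ ^ 2 < (r - K * τ) ^ 2 := by gcongr
  have : 0 < max ((r - K * τ) ^ 2 - ‖y - y₀‖ ^ 2) 0 := lt_max_of_lt_left (sub_pos.2 h2)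
  unfold coneWeight; positivity

/-- Domain of dependence: a nonnegative energy density `e` with flux `f` of speed at most `K`,
which vanishes initially in a ball, vanishes in the backward cone over that ball. -/
theorem energy_eq_zero_on_cone {T K M : ℝ} (hT : 0 < T) (hK : 0 ≤ K) {e : ℝ × E3 → ℝ}
    {f : Fin 3 → ℝ × E3 → ℝ} (he : ContDiffOn ℝ 1 e (slab T))
    (hf : ∀ k, ContDiffOn ℝ 1 (f k) (slab T)) (he0 : ∀ p ∈ slab T, 0 ≤ e p)
    (hflux : ∀ p ∈ slab T, ∀ v : E3, |∑ k, v k * f k p| ≤ K * ‖v‖ * e p)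
    (hinit : ∀ y ∈ Metric.ball y₀ r, e (0, y) = 0)
    (hineq : ∀ τ ∈ Ioo 0 T, ∀ y ∈ Metric.ball y₀ r,
      fderivWithin ℝ e (slab T) (τ, y) (1, 0) + ∑ k, pderiv k (fun x => f k (τ, x)) y
        ≤ M * e (τ, y))
    (hr : 0 ≤ r - K * T) {y : E3} (hy : ‖y - y₀‖ < r - K * T) : e (T, y) = 0 := by
  have hrt : ∀ τ ∈ Icc 0 T, 0 ≤ r - K * τ := fun τ hτ =>
    hr.trans (by have := mul_le_mul_of_nonneg_left hτ.2 hK; linarith)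
  set φ := coneWeight r K y₀ with hφ
  set g : ℝ × E3 → ℝ := fun p => φ p * e p with hgdef
  have hg : ContDiffOn ℝ 1 g (slab T) := contDiff_coneWeight.contDiffOn.mul he
  have hφ0 : ∀ τ ∈ Icc 0 T, ∀ y ∉ Metric.ball y₀ r, φ (τ, y) = 0 := fun τ hτ y hy =>
    coneWeight_eq_zero (hrt τ hτ) fun h => hy
      (Metric.ball_subset_ball (by have := mul_nonneg hK hτ.1; linarith) h)
  have hφ0' : ∀ τ ∈ Icc 0 T, ∀ y ∉ Metric.closedBall y₀ r, φ (τ, y) = 0 := fun τ hτ y hy =>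
    hφ0 τ hτ y fun h => hy (Metric.ball_subset_closedBall h)
  have hgsupp : ∀ τ ∈ Icc 0 T, ∀ y ∉ Metric.closedBall y₀ r, g (τ, y) = 0 :=
    fun τ hτ y hy => by simp [hgdef, hφ0' τ hτ y hy]
  have hg0 : ∀ p ∈ slab T, 0 ≤ g p := fun p hp => mul_nonneg (coneWeight_nonneg p) (he0 p hp)
  have hcs : ∀ τ ∈ Icc 0 T, HasCompactSupport fun y => g (τ, y) := fun τ hτ =>
    HasCompactSupport.intro (isCompact_closedBall y₀ r) (hgsupp τ hτ)
  set I : ℝ → ℝ := fun τ => ∫ y, g (τ, y) with hI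
  have hIcont : ContinuousOn I (Icc 0 T) :=
    continuousOn_integral_of_compact_support (f := fun t y => g (t, y))
      (isCompact_closedBall y₀ r) hg.continuousOn fun t y ht hy => hgsupp t ht y hy
  have hIderiv : ∀ τ ∈ Ioo 0 T, ∃ I', HasDerivAt I I' τ ∧ I' ≤ M * I τ := by
    intro τ hτ
    have hτ' := Ioo_subset_Icc_self hτ
    refine ⟨_, hasDerivAt_integral_slab hT hg hgsupp hτ, ?_⟩
    set m : E3 → ℝ := fun y => max ((r - K * τ) ^ 2 - ‖y - y₀‖ ^ 2) 0 with hm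
    have hφc : ContDiff ℝ 1 fun y => φ (τ, y) := contDiff_coneWeight.comp (by fun_prop)
    have hφcs : HasCompactSupport fun y => φ (τ, y) :=
      HasCompactSupport.intro (isCompact_closedBall y₀ r) (hφ0' τ hτ')
    have hfc : ∀ k, ContDiff ℝ 1 fun y => f k (τ, y) := fun k => contDiff_slice (hf k) hτ'
    have hfd : ∀ k, Continuous (pderiv k fun y => f k (τ, y)) := fun k =>
      ((hfc k).continuous_fderiv one_ne_zero).clm_apply continuous_const
    have hφd : ∀ k, Continuous (pderiv k fun y => φ (τ, y)) := fun k =>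
      (hφc.continuous_fderiv one_ne_zero).clm_apply continuous_const
    have hφdcs : ∀ k, HasCompactSupport (pderiv k fun y => φ (τ, y)) := fun k =>
      hφcs.fderiv_apply (𝕜 := ℝ) (EuclideanSpace.single k (1 : ℝ))
    have hi1 : ∀ k, Integrable fun y => φ (τ, y) * pderiv k (fun x => f k (τ, x)) y := fun k =>
      (hφc.continuous.mul (hfd k)).integrable_of_hasCompactSupport hφcs.mul_right
    have hi2 : ∀ k, Integrable fun y => pderiv k (fun x => φ (τ, x)) y * f k (τ, y) := fun k =>
      ((hφd k).mul (hfc k).continuous).integrable_of_hasCompactSupport (hφdcs k).mul_right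
    have hi3 : Integrable fun y => g (τ, y) :=
      (contDiff_slice hg hτ').continuous.integrable_of_hasCompactSupport (hcs τ hτ')
    have hibp : ∀ k, ∫ y, φ (τ, y) * pderiv k (fun x => f k (τ, x)) y
        = -∫ y, pderiv k (fun x => φ (τ, x)) y * f k (τ, y) := fun k =>
      integral_mul_fderiv_eq_neg_fderiv_mul_of_integrable (hi2 k) (hi1 k)
        ((hφc.continuous.mul (hfc k).continuous).integrable_of_hasCompactSupport hφcs.mul_right)
        (fun x _ => hφc.differentiable one_ne_zero x)
        (fun x _ => (hfc k).differentiable one_ne_zero x)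
    have hprod : ∀ y, fderivWithin ℝ g (slab T) (τ, y) (1, 0)
        = -(4 * K * (r - K * τ) * m y) * e (τ, y)
          + φ (τ, y) * fderivWithin ℝ e (slab T) (τ, y) (1, 0) := by
      intro y
      rw [← (hasDerivAt_slice hg hτ y).deriv]
      exact ((hasDerivAt_coneWeight_time τ y).mul (hasDerivAt_slice he hτ y)).deriv
    -- The loss $-4K(r-K\tau)m\,e$ absorbs $\nabla\varphi\cdot f$ by the flux bound. The right side
    -- is arranged so that its last two sums cancel under the integral, by the integration by parts
    -- `hibp`.
    have hpt : ∀ y, fderivWithin ℝ g (slab T) (τ, y) (1, 0)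
        ≤ M * g (τ, y) - (∑ k, φ (τ, y) * pderiv k (fun x => f k (τ, x)) y)
          - ∑ k, pderiv k (fun x => φ (τ, x)) y * f k (τ, y) := by
      intro y
      have hm0 : 0 ≤ m y := le_max_right _ _
      have hsp : ∑ k, pderiv k (fun x => φ (τ, x)) y * f k (τ, y)
          = -(4 * m y * ∑ k, (y - y₀) k * f k (τ, y)) := by
        rw [Finset.mul_sum, ← Finset.sum_neg_distrib]
        refine Finset.sum_congr rfl fun k _ => ?_
        have hin : inner ℝ (y - y₀) (EuclideanSpace.single k (1 : ℝ)) = (y - y₀) k := by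
          rw [EuclideanSpace.inner_single_right]; simp
        rw [pderiv, fderiv_coneWeight_space, hin]
        ring
      have h1 : φ (τ, y) * (fderivWithin ℝ e (slab T) (τ, y) (1, 0)
          + ∑ k, pderiv k (fun x => f k (τ, x)) y) ≤ φ (τ, y) * (M * e (τ, y)) := by
        by_cases hyb : y ∈ Metric.ball y₀ r
        · exact mul_le_mul_of_nonneg_left (hineq τ hτ y hyb) (coneWeight_nonneg _)
        · simp [hφ0 τ hτ' y hyb]
      have h2 : m y * |∑ k, (y - y₀) k * f k (τ, y)| ≤ m y * (K * (r - K * τ) * e (τ, y)) := by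
        by_cases hyb : ‖y - y₀‖ < r - K * τ
        · refine mul_le_mul_of_nonneg_left ((hflux (τ, y) (mem_slab.2 hτ') (y - y₀)).trans ?_) hm0
          have := he0 (τ, y) (mem_slab.2 hτ')
          gcongr
        · have h3 : (r - K * τ) ^ 2 ≤ ‖y - y₀‖ ^ 2 := by
            have := hrt τ hτ'
            have := not_lt.1 hyb
            gcongr
          have : m y = 0 := max_eq_right (sub_nonpos.2 h3)
          simp [this]
      have h3 := mul_le_mul_of_nonneg_left (neg_abs_le (∑ k, (y - y₀) k * f k (τ, y))) hm0
      rw [hprod, hsp, ← Finset.mul_sum]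
      simp only [hgdef]
      nlinarith
    have hi4 : Integrable fun y => fderivWithin ℝ g (slab T) (τ, y) (1, 0) := by
      refine Continuous.integrable_of_hasCompactSupport ?_ (HasCompactSupport.intro
        (isCompact_closedBall y₀ r) fun y hy => ?_)
      · have hcont : ContinuousOn (fun p => fderivWithin ℝ g (slab T) p (1, 0)) (slab T) :=
          (continuousOn_fderivWithin_slab hT hg).clm_apply continuousOn_const
        exact continuousOn_univ.1 (hcont.comp (f := fun y : E3 => (τ, y)) (s := univ)
          (by fun_prop) fun y _ => mem_slab.2 hτ')
      · rw [hprod, hφ0' τ hτ' y hy]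
        have : ‖y - y₀‖ ≥ r - K * τ := by
          rw [Metric.mem_closedBall, dist_eq_norm, not_le] at hy
          have := mul_nonneg hK hτ'.1
          linarith
        have h3 : (r - K * τ) ^ 2 ≤ ‖y - y₀‖ ^ 2 := by
          have := hrt τ hτ'
          gcongr
        simp [hm, max_eq_right (sub_nonpos.2 h3)]
    have h5 := integral_mono hi4 (((hi3.const_mul M).sub
      (integrable_finsetSum Finset.univ fun k _ => hi1 k)).sub
      (integrable_finsetSum Finset.univ fun k _ => hi2 k)) hpt
    refine h5.trans (le_of_eq ?_)
    change ∫ y, (M * g (τ, y) - ∑ k, φ (τ, y) * pderiv k (fun x => f k (τ, x)) y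
      - ∑ k, pderiv k (fun x => φ (τ, x)) y * f k (τ, y)) = M * I τ
    rw [integral_sub (f := fun y => M * g (τ, y) - ∑ k, φ (τ, y) * pderiv k (fun x => f k (τ, x)) y)
      ((hi3.const_mul M).sub (integrable_finsetSum Finset.univ fun k _ => hi1 k))
      (integrable_finsetSum Finset.univ fun k _ => hi2 k),
      integral_sub (hi3.const_mul M) (integrable_finsetSum Finset.univ fun k _ => hi1 k),
      integral_finsetSum _ fun k _ => hi1 k, integral_finsetSum _ fun k _ => hi2 k,
      integral_const_mul]
    simp only [hibp, Finset.sum_neg_distrib]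
    ring
  -- Grönwall: $I'\le MI$ makes $Ie^{-M\tau}$ nonincreasing, and $I(0)=0$.
  have hanti : AntitoneOn (fun τ => I τ * Real.exp (-M * τ)) (Icc 0 T) := by
    have hexp : ∀ τ, HasDerivAt (fun τ => Real.exp (-M * τ)) (Real.exp (-M * τ) * (-M)) τ :=
      fun τ => by simpa using ((hasDerivAt_id τ).const_mul (-M)).exp
    refine antitoneOn_of_deriv_nonpos (convex_Icc 0 T)
      (hIcont.mul (by fun_prop)) (fun τ hτ => ?_) fun τ hτ => ?_
    · rw [interior_Icc] at hτ
      obtain ⟨I', h1, -⟩ := hIderiv τ hτ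
      exact (h1.mul (hexp τ)).differentiableAt.differentiableWithinAt
    · rw [interior_Icc] at hτ
      obtain ⟨I', h1, h2⟩ := hIderiv τ hτ
      refine (HasDerivAt.deriv (h1.mul (hexp τ))).trans_le ?_
      have := mul_le_mul_of_nonneg_right h2 (Real.exp_pos (-M * τ)).le
      linarith
  have h0mem : (0 : ℝ) ∈ Icc 0 T := left_mem_Icc.2 hT.le
  have hTmem : T ∈ Icc 0 T := right_mem_Icc.2 hT.le
  have hI0 : I 0 = 0 := by
    have : ∀ y, g (0, y) = 0 := fun y => by
      by_cases hyb : y ∈ Metric.ball y₀ r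
      · simp [hgdef, hinit y hyb]
      · simp [hgdef, hφ0 0 h0mem y hyb]
    simp [hI, this]
  have hIT : I T ≤ 0 := by
    have := hanti h0mem hTmem hT.le
    simp only [hI0, zero_mul] at this
    exact nonpos_of_mul_nonpos_left this (Real.exp_pos _)
  by_contra hne
  refine absurd hIT (not_le.2 ?_)
  -- A continuous nonnegative function with nonpositive integral vanishes identically, and the
  -- weight is positive at $y$.
  exact (contDiff_slice hg hTmem).continuous.integral_pos_of_hasCompactSupport_nonneg_nonzero
    (hcs T hTmem) (fun y => hg0 (T, y) (mem_slab.2 hTmem)) (x := y)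
    (mul_ne_zero (coneWeight_pos hy).ne' hne)

end Energy

/-! ### The background motion in the rescaled time -/

namespace AffineMotion

variable {α : ℝ} (B : AffineMotion α)

lemma contDiff_A (i j : Fin 3) : ContDiff ℝ 1 fun t => B.A t i j := by
  rw [contDiff_one_iff_deriv]
  refine ⟨fun t => (B.hasDeriv_A t i j).differentiableAt, ?_⟩
  rw [funext fun t => (B.hasDeriv_A t i j).deriv]
  exact continuous_iff_continuousAt.2 fun t => (B.hasDeriv_A' t i j).continuousAt

lemma contDiff_detA : ContDiff ℝ 1 fun t => (B.A t).det :=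
  contDiffOn_univ.1 (contDiffOn_det fun i j => (B.contDiff_A i j).contDiffOn)

lemma contDiff_muT : ContDiff ℝ 1 B.muT :=
  B.contDiff_detA.rpow_const_of_ne fun t => (B.det_pos t).ne'

lemma muT_pos (t : ℝ) : 0 < B.muT t := Real.rpow_pos_of_pos (B.det_pos t) _

lemma hasDerivAt_tau (t : ℝ) : HasDerivAt B.tau (1 / B.muT t) t := by
  have hc : Continuous fun s => 1 / B.muT s :=
    continuous_const.div B.contDiff_muT.continuous fun s => (B.muT_pos s).ne'
  exact intervalIntegral.integral_hasDerivAt_right (hc.intervalIntegrable _ _)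
    (hc.stronglyMeasurableAtFilter _ _) hc.continuousAt

lemma continuous_tau : Continuous B.tau :=
  continuous_iff_continuousAt.2 fun t => (B.hasDerivAt_tau t).continuousAt

lemma strictMono_tau : StrictMono B.tau :=
  strictMono_of_deriv_pos fun t => by
    rw [(B.hasDerivAt_tau t).deriv]; exact one_div_pos.2 (B.muT_pos t)

@[simp] lemma tau_zero : B.tau 0 = 0 := by simp [tau]

lemma exists_muT_le : ∃ c, 0 < c ∧ ∀ t, 0 ≤ t → B.muT t ≤ c * (1 + t) := by
  obtain ⟨c₁, c₂, h1, h⟩ := B.det_growth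
  have h0 := h 0 le_rfl
  have hc₂ : 0 < c₂ := by
    have := h0.1.trans h0.2
    norm_num at this
    linarith
  refine ⟨c₂ ^ ((1 : ℝ) / 3), Real.rpow_pos_of_pos hc₂ _, fun t ht => ?_⟩
  have h2 : (B.A t).det ≤ c₂ * (1 + t) ^ 3 := by
    refine (h t ht).2.trans (mul_le_mul_of_nonneg_left ?_ hc₂.le)
    nlinarith [mul_nonneg ht ht]
  calc B.muT t ≤ (c₂ * (1 + t) ^ 3) ^ ((1 : ℝ) / 3) :=
        Real.rpow_le_rpow (B.det_pos t).le h2 (by norm_num)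
    _ = c₂ ^ ((1 : ℝ) / 3) * (1 + t) := by
        rw [Real.mul_rpow hc₂.le (by positivity), ← Real.rpow_natCast (1 + t) 3,
          ← Real.rpow_mul (by positivity)]
        norm_num

/-- As $\mu$ grows at most linearly in $t$, the integral of $1/\mu$ diverges at least
logarithmically. Hence $\tau$ runs through all of $[0,\infty)$, and `time` is a genuine right
inverse there. -/
lemma exists_tau_ge : ∃ c, 0 < c ∧ ∀ t, 0 ≤ t → c * Real.log (1 + t) ≤ B.tau t := by
  obtain ⟨c, hc, h⟩ := B.exists_muT_le
  refine ⟨1 / c, by positivity, fun t ht => ?_⟩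
  have hd : ∀ t, 0 ≤ t → HasDerivAt (fun t => B.tau t - 1 / c * Real.log (1 + t))
      (1 / B.muT t - 1 / c * (1 / (1 + t))) t := fun t ht =>
    (B.hasDerivAt_tau t).sub ((((hasDerivAt_id t).const_add 1).log
      (by simp; positivity)).const_mul _)
  have hmono : MonotoneOn (fun t => B.tau t - 1 / c * Real.log (1 + t)) (Ici 0) := by
    refine monotoneOn_of_deriv_nonneg (convex_Ici 0)
      (fun t ht => (hd t ht).continuousAt.continuousWithinAt) (fun t ht => ?_) fun t ht => ?_
    · rw [interior_Ici] at ht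
      exact (hd t (le_of_lt ht)).differentiableAt.differentiableWithinAt
    · rw [interior_Ici] at ht
      have ht' : 0 < t := ht
      rw [(hd t ht'.le).deriv, sub_nonneg, one_div_mul_one_div]
      exact one_div_le_one_div_of_le (B.muT_pos t) (h t ht'.le)
  have := hmono self_mem_Ici (mem_Ici.2 ht) ht
  simp at this
  simpa using this

lemma exists_tau_eq {τ : ℝ} (hτ : 0 ≤ τ) : ∃ t ∈ Ici (0 : ℝ), B.tau t = τ := by
  obtain ⟨c, hc, h⟩ := B.exists_tau_ge
  have h1 : 0 ≤ Real.exp (τ / c) - 1 := by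
    have := Real.one_le_exp (show 0 ≤ τ / c by positivity); linarith
  have h2 : τ ≤ B.tau (Real.exp (τ / c) - 1) := by
    have := h _ h1
    rw [add_sub_cancel, Real.log_exp] at this
    rwa [mul_div_cancel₀ _ hc.ne'] at this
  obtain ⟨t, ht, hteq⟩ := intermediate_value_Icc h1 B.continuous_tau.continuousOn
    (show τ ∈ Icc (B.tau 0) _ by simpa using ⟨hτ, h2⟩)
  exact ⟨t, ht.1, hteq⟩

lemma tau_time {τ : ℝ} (hτ : 0 ≤ τ) : B.tau (B.time τ) = τ :=
  Function.invFunOn_eq (B.exists_tau_eq hτ)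

lemma continuousOn_time : ContinuousOn B.time (Ici 0) := by
  -- A strictly increasing continuous function with interval range is a topological embedding, so
  -- continuity of `time` may be tested after composition with `tau`, where it is the identity.
  have h := B.strictMono_tau.isEmbedding_of_ordConnected
    (isPreconnected_range B.continuous_tau).ordConnected
  rw [h.isInducing.continuousOn_iff]
  exact continuousOn_id.congr fun τ hτ => B.tau_time hτ

lemma hasDerivWithinAt_time {τ : ℝ} (hτ : 0 ≤ τ) :
    HasDerivWithinAt B.time (B.mu τ) (Ici 0) τ := by
  have h1 : HasDerivAt B.tau (1 / B.muT (B.time τ)) (B.time τ) := B.hasDerivAt_tau _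
  have hne : 1 / B.muT (B.time τ) ≠ 0 := one_div_ne_zero (B.muT_pos _).ne'
  have h2 : HasFDerivWithinAt B.tau ((ContinuousLinearEquiv.unitsEquivAut ℝ (Units.mk0 _ hne) :
      ℝ ≃L[ℝ] ℝ) : ℝ →L[ℝ] ℝ) univ (B.time τ) := by
    refine HasFDerivAt.hasFDerivWithinAt ?_
    have h : ((ContinuousLinearEquiv.unitsEquivAut ℝ (Units.mk0 _ hne) : ℝ ≃L[ℝ] ℝ) : ℝ →L[ℝ] ℝ)
        = ContinuousLinearMap.toSpanSingleton ℝ (1 / B.muT (B.time τ)) := by ext; simp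
    rw [h]
    exact h1.hasFDerivAt
  have h3 : HasFDerivWithinAt B.time _ (Ici 0) τ := h2.of_local_left_inverse (t := univ)
    (by simpa [ContinuousWithinAt] using B.continuousOn_time τ hτ) hτ
    (Filter.eventually_of_mem self_mem_nhdsWithin fun x hx => B.tau_time hx)
  have h4 := h3.hasDerivWithinAt
  simpa [mu] using h4

lemma contDiffOn_time : ContDiffOn ℝ 1 B.time (Ici 0) := by
  rw [contDiffOn_one_iff_derivWithin (uniqueDiffOn_Ici 0)]
  refine ⟨fun τ hτ => (B.hasDerivWithinAt_time hτ).differentiableWithinAt, ?_⟩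
  refine ContinuousOn.congr (f := B.mu) ?_ fun τ hτ =>
    (B.hasDerivWithinAt_time hτ).derivWithin (uniqueDiffOn_Ici 0 τ hτ)
  exact B.contDiff_muT.continuous.comp_continuousOn B.continuousOn_time

lemma contDiffOn_Aτ (i j : Fin 3) : ContDiffOn ℝ 1 (fun τ => B.Aτ τ i j) (Ici 0) :=
  (B.contDiff_A i j).comp_contDiffOn B.contDiffOn_time

lemma contDiffOn_mu : ContDiffOn ℝ 1 B.mu (Ici 0) :=
  B.contDiff_muT.comp_contDiffOn B.contDiffOn_time

lemma mu_pos (τ : ℝ) : 0 < B.mu τ := B.muT_pos _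

lemma det_Aτ_pos (τ : ℝ) : 0 < (B.Aτ τ).det := B.det_pos _

lemma contDiffOn_O (i j : Fin 3) : ContDiffOn ℝ 1 (fun τ => B.O τ i j) (Ici 0) := by
  simp only [O, Matrix.smul_apply, smul_eq_mul]
  exact (B.contDiffOn_mu.inv fun τ _ => (B.mu_pos τ).ne').mul (B.contDiffOn_Aτ i j)

lemma det_O_ne_zero (τ : ℝ) : (B.O τ).det ≠ 0 := by
  rw [O, Matrix.det_smul]
  exact mul_ne_zero (pow_ne_zero _ (inv_ne_zero (B.mu_pos τ).ne')) (B.det_Aτ_pos τ).ne'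

lemma continuousOn_muDot : ContinuousOn B.muDot (Ici 0) :=
  B.contDiffOn_mu.continuousOn_derivWithin (uniqueDiffOn_Ici 0) le_rfl

lemma continuousOn_Gam (i j : Fin 3) : ContinuousOn (fun τ => B.Gam τ i j) (Ici 0) := by
  simp only [Gam, Matrix.mul_apply, ODot, Matrix.of_apply]
  exact continuousOn_finsetSum _ fun k _ =>
    (contDiffOn_inv B.contDiffOn_O (fun τ _ => B.det_O_ne_zero τ) i k).continuousOn.mul
      ((B.contDiffOn_O k j).continuousOn_derivWithin (uniqueDiffOn_Ici 0) le_rfl)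

lemma Cbar_pos : 0 < B.Cbar := mul_pos B.Tbar_pos (Real.rpow_pos_of_pos (B.det_pos 0) _)

/-- The symmetric matrix `Λ⁻¹ = (det A)^{-2/3} Aᵀ A`. -/
noncomputable def LamInv (τ : ℝ) : M3 :=
  (B.Aτ τ).det ^ (-((2 : ℝ) / 3)) • ((B.Aτ τ).transpose * B.Aτ τ)

lemma LamInv_mul_Lam (τ : ℝ) : B.LamInv τ * B.Lam τ = 1 := by
  have hd := B.det_Aτ_pos τ
  have hu : IsUnit (B.Aτ τ).det := isUnit_iff_ne_zero.2 hd.ne'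
  have hut : IsUnit (B.Aτ τ).transpose.det := by rwa [Matrix.det_transpose]
  rw [LamInv, Lam, Matrix.smul_mul, Matrix.mul_smul, smul_smul, ← Real.rpow_add hd,
    neg_add_cancel, Real.rpow_zero, one_smul, Matrix.mul_assoc, ← Matrix.mul_assoc (B.Aτ τ),
    Matrix.mul_nonsing_inv _ hu, Matrix.one_mul, Matrix.transpose_nonsing_inv,
    Matrix.mul_nonsing_inv _ hut]

lemma contDiffOn_LamInv (i j : Fin 3) : ContDiffOn ℝ 1 (fun τ => B.LamInv τ i j) (Ici 0) := by
  simp only [LamInv, Matrix.smul_apply, smul_eq_mul]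
  refine ((contDiffOn_det B.contDiffOn_Aτ).rpow_const_of_ne
    fun τ _ => (B.det_Aτ_pos τ).ne').mul ?_
  exact contDiffOn_mul (m₁ := fun τ => (B.Aτ τ).transpose) (fun i j => B.contDiffOn_Aτ j i)
    B.contDiffOn_Aτ i j

lemma LamInv_symm (τ : ℝ) (i j : Fin 3) : B.LamInv τ i j = B.LamInv τ j i := by
  simp only [LamInv, Matrix.smul_apply, Matrix.mul_apply, Matrix.transpose_apply, mul_comm]

/-- With $u=Av$ the quadratic form is $(\det A)^{-2/3}|u|^2$. Cauchy–Schwarz applied to $v=A^{-1}u$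
bounds $|v|^2$ by $|u|^2$ times the squared entries of $A^{-1}$, and compactness in time makes the
constant uniform. -/
lemma exists_LamInv_coercive (T : ℝ) : ∃ c, 0 < c ∧ ∀ τ ∈ Icc 0 T, ∀ v : Fin 3 → ℝ,
    c * ∑ i, v i ^ 2 ≤ ∑ i, ∑ j, v i * B.LamInv τ i j * v j := by
  have hcont : ContinuousOn (fun τ => (B.Aτ τ).det ^ ((2 : ℝ) / 3)
      * ∑ i, ∑ k, ((B.Aτ τ)⁻¹ i k) ^ 2) (Icc 0 T) := by
    refine ContinuousOn.mono (s := Ici 0) ?_ Icc_subset_Ici_self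
    refine ((contDiffOn_det B.contDiffOn_Aτ).rpow_const_of_ne
      fun τ _ => (B.det_Aτ_pos τ).ne').continuousOn.mul ?_
    exact continuousOn_finsetSum _ fun i _ => continuousOn_finsetSum _ fun k _ =>
      (contDiffOn_inv B.contDiffOn_Aτ (fun τ _ => (B.det_Aτ_pos τ).ne') i k).continuousOn.pow 2
  obtain ⟨M, hM⟩ := isCompact_Icc.exists_bound_of_continuousOn hcont
  refine ⟨1 / (|M| + 1), by positivity, fun τ hτ v => ?_⟩
  have hd := B.det_Aτ_pos τ
  set u : Fin 3 → ℝ := (B.Aτ τ).mulVec v with hu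
  have hq : ∑ i, ∑ j, v i * B.LamInv τ i j * v j
      = (B.Aτ τ).det ^ (-((2 : ℝ) / 3)) * ∑ k, u k ^ 2 := by
    simp only [LamInv, Matrix.smul_apply, Matrix.mul_apply, Matrix.transpose_apply, smul_eq_mul,
      hu, Matrix.mulVec, dotProduct, Fin.sum_univ_three]
    ring
  have hv : v = (B.Aτ τ)⁻¹.mulVec u := by
    rw [hu, Matrix.mulVec_mulVec, Matrix.nonsing_inv_mul _ (isUnit_iff_ne_zero.2 hd.ne'),
      Matrix.one_mulVec]
  have h1 : ∑ i, v i ^ 2 ≤ (∑ i, ∑ k, ((B.Aτ τ)⁻¹ i k) ^ 2) * ∑ k, u k ^ 2 := by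
    rw [Finset.sum_mul]
    refine Finset.sum_le_sum fun i _ => ?_
    rw [congrFun hv i]
    exact Finset.sum_mul_sq_le_sq_mul_sq Finset.univ (fun k => (B.Aτ τ)⁻¹ i k) u
  have hu0 : 0 ≤ ∑ k, u k ^ 2 := Finset.sum_nonneg fun k _ => sq_nonneg _
  have h2 : (B.Aτ τ).det ^ ((2 : ℝ) / 3) * ∑ i, ∑ k, ((B.Aτ τ)⁻¹ i k) ^ 2 ≤ |M| + 1 :=
    (le_abs_self _).trans ((hM τ hτ).trans ((le_abs_self M).trans (by linarith)))
  have hp : 0 < (B.Aτ τ).det ^ ((2 : ℝ) / 3) := Real.rpow_pos_of_pos hd _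
  rw [hq, Real.rpow_neg hd.le, one_div, ← div_eq_inv_mul, ← div_eq_inv_mul, div_le_div_iff₀
    (by positivity) hp]
  calc (∑ i, v i ^ 2) * (B.Aτ τ).det ^ ((2 : ℝ) / 3)
      ≤ ((∑ i, ∑ k, ((B.Aτ τ)⁻¹ i k) ^ 2) * ∑ k, u k ^ 2) * (B.Aτ τ).det ^ ((2 : ℝ) / 3) := by
        gcongr
    _ = (∑ k, u k ^ 2)
        * ((B.Aτ τ).det ^ ((2 : ℝ) / 3) * ∑ i, ∑ k, ((B.Aτ τ)⁻¹ i k) ^ 2) := by ring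
    _ ≤ (∑ k, u k ^ 2) * (|M| + 1) := by gcongr

/-- The momentum equation, solved for the pressure force. -/
lemma exists_symmetrizer (σ T : ℝ) : ∃ S D : ℝ → M3,
    (∀ i j, ContDiffOn ℝ 1 (fun τ => S τ i j) (Icc 0 T)) ∧
    (∀ i j, ContinuousOn (fun τ => D τ i j) (Icc 0 T)) ∧
    (∀ τ i j, S τ i j = S τ j i) ∧
    (∃ c, 0 < c ∧ ∀ τ ∈ Icc 0 T, ∀ v : Fin 3 → ℝ,
      c * ∑ i, v i ^ 2 ≤ ∑ i, ∑ j, v i * S τ i j * v j) ∧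
    ∀ τ (a v x : Fin 3 → ℝ), (∀ i, B.mu τ ^ σ * a i + B.muDot τ * B.mu τ ^ (-1 + σ) * v i
      + 2 * B.mu τ ^ σ * ∑ j, B.Gam τ i j * v j
      + B.Cbar * B.mu τ ^ (-(3 / α - σ)) * ∑ l, B.Lam τ i l * x l = 0) →
      ∀ i, ∑ j, S τ i j * a j + ∑ j, D τ i j * v j + x i = 0 := by
  have hmu : ∀ e : ℝ, ContDiffOn ℝ 1 (fun τ => B.mu τ ^ e) (Ici 0) := fun e =>
    B.contDiffOn_mu.rpow_const_of_ne fun τ _ => (B.mu_pos τ).ne'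
  have hpos : ∀ (e : ℝ) τ, 0 < B.mu τ ^ e := fun e τ => Real.rpow_pos_of_pos (B.mu_pos τ) e
  -- $p=\mu^\delta/\overline C$ cancels the coefficient $\overline C\mu^{-\delta}$ of the force.
  -- Multiplication by $p\Lambda^{-1}$ therefore isolates $x$ and leaves $S=p\mu^\sigma\Lambda^{-1}$
  -- before the acceleration; friction and rotation go into $D$.
  set p : ℝ → ℝ := fun τ => B.Cbar⁻¹ * B.mu τ ^ (3 / α - σ) with hp
  have hpc : ContDiffOn ℝ 1 p (Ici 0) := contDiffOn_const.mul (hmu _)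
  have hppos : ∀ τ, 0 < p τ := fun τ => mul_pos (inv_pos.2 B.Cbar_pos) (hpos _ τ)
  refine ⟨fun τ => (p τ * B.mu τ ^ σ) • B.LamInv τ,
    fun τ => B.LamInv τ * Matrix.of fun i j => p τ * (B.muDot τ * B.mu τ ^ (-1 + σ) *
      (1 : M3) i j + 2 * B.mu τ ^ σ * B.Gam τ i j), fun i j => ?_, fun i j => ?_, fun τ i j => ?_,
    ?_, fun τ a v x h i => ?_⟩
  · simp only [Matrix.smul_apply, smul_eq_mul]
    exact ((hpc.mul (hmu σ)).mul (B.contDiffOn_LamInv i j)).mono Icc_subset_Ici_self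
  · simp only [Matrix.mul_apply, Matrix.of_apply]
    refine ContinuousOn.mono (s := Ici 0) ?_ Icc_subset_Ici_self
    refine continuousOn_finsetSum _ fun k _ => (B.contDiffOn_LamInv i k).continuousOn.mul ?_
    exact hpc.continuousOn.mul (((B.continuousOn_muDot.mul (hmu _).continuousOn).mul
      continuousOn_const).add ((continuousOn_const.mul (hmu _).continuousOn).mul
      (B.continuousOn_Gam k j)))
  · simp only [Matrix.smul_apply, B.LamInv_symm τ i j]
  · obtain ⟨c, hc, hcoer⟩ := B.exists_LamInv_coercive T
    have hcont : ContinuousOn (fun τ => (p τ * B.mu τ ^ σ)⁻¹) (Icc 0 T) :=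
      ((hpc.mul (hmu σ)).continuousOn.mono Icc_subset_Ici_self).inv₀
        fun τ _ => (mul_pos (hppos τ) (hpos σ τ)).ne'
    obtain ⟨M, hM⟩ := isCompact_Icc.exists_bound_of_continuousOn hcont
    refine ⟨1 / (|M| + 1) * c, by positivity, fun τ hτ v => ?_⟩
    have hs := mul_pos (hppos τ) (hpos σ τ)
    have h1 : 1 / (|M| + 1) ≤ p τ * B.mu τ ^ σ := by
      rw [one_div]
      refine inv_le_of_inv_le₀ hs ?_
      exact (le_abs_self _).trans ((hM τ hτ).trans ((le_abs_self M).trans (by linarith)))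
    have h2 : 0 ≤ ∑ i, v i ^ 2 := Finset.sum_nonneg fun i _ => sq_nonneg _
    calc 1 / (|M| + 1) * c * ∑ i, v i ^ 2 ≤ (p τ * B.mu τ ^ σ) * c * ∑ i, v i ^ 2 := by gcongr
      _ = (p τ * B.mu τ ^ σ) * (c * ∑ i, v i ^ 2) := by ring
      _ ≤ (p τ * B.mu τ ^ σ) * ∑ i, ∑ j, v i * B.LamInv τ i j * v j :=
        mul_le_mul_of_nonneg_left (hcoer τ hτ v) hs.le
      _ = _ := by
        simp only [Finset.mul_sum, Matrix.smul_apply, smul_eq_mul]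
        refine Finset.sum_congr rfl fun i _ => Finset.sum_congr rfl fun j _ => by ring
  · have hk : p τ * (B.Cbar * B.mu τ ^ (-(3 / α - σ))) = 1 := by
      rw [hp, Real.rpow_neg (B.mu_pos τ).le]
      have := (hpos (3 / α - σ) τ).ne'
      have := B.Cbar_pos.ne'
      field_simp
    have hx : ∑ l, B.LamInv τ i l * ∑ k, B.Lam τ l k * x k = x i := by
      have := congrFun (congrArg (fun m : M3 => m.mulVec x) (B.LamInv_mul_Lam τ)) i
      simp only [← Matrix.mulVec_mulVec, Matrix.one_mulVec] at this
      exact this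
    have hx' : x i = p τ * (B.Cbar * B.mu τ ^ (-(3 / α - σ)))
        * ∑ l, B.LamInv τ i l * ∑ k, B.Lam τ l k * x k := by rw [hk, one_mul, hx]
    have hsum := Finset.sum_congr (rfl : Finset.univ = Finset.univ)
      fun l _ => congrArg (fun z => p τ * B.LamInv τ i l * z) (h l)
    simp only [mul_zero, Finset.sum_const_zero] at hsum
    rw [← hsum]
    simp only [Fin.sum_univ_three] at hx'
    simp only [Matrix.smul_apply, Matrix.mul_apply, Matrix.of_apply, smul_eq_mul,
      Fin.sum_univ_three, Matrix.one_apply, Fin.isValue, Fin.reduceEq, ↓reduceIte]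
    linear_combination hx'

end AffineMotion

/-! ### Derivatives on the slab -/

section SlabDerivatives

variable {T : ℝ}

/-- The derivative in the direction `a` of a function on the slab. -/
noncomputable def slabD (T : ℝ) (a : ℝ × E3) (g : ℝ × E3 → ℝ) (p : ℝ × E3) : ℝ :=
  fderivWithin ℝ g (slab T) p a

/-- The direction of time. -/
def dirT : ℝ × E3 := (1, 0)

/-- The direction of the `k`-th space coordinate. -/
noncomputable def dirX (k : Fin 3) : ℝ × E3 := (0, EuclideanSpace.single k 1)

lemma dirX_snd (k i : Fin 3) : (dirX k).2 i = if i = k then 1 else 0 := by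
  simp [dirX, PiLp.single_apply]

lemma slabD_congr {f g : ℝ × E3 → ℝ} (h : EqOn f g (slab T)) {p : ℝ × E3} (hp : p ∈ slab T)
    {a : ℝ × E3} : slabD T a f p = slabD T a g p := by
  rw [slabD, slabD, fderivWithin_congr h (h hp)]

lemma contDiffOn_slabD (hT : 0 < T) (a : ℝ × E3) {g : ℝ × E3 → ℝ}
    (hg : ContDiffOn ℝ 2 g (slab T)) : ContDiffOn ℝ 1 (slabD T a g) (slab T) :=
  (hg.fderivWithin (uniqueDiffOn_slab hT) (by norm_num)).clm_apply contDiffOn_const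

lemma continuousOn_slabD (hT : 0 < T) (a : ℝ × E3) {g : ℝ × E3 → ℝ}
    (hg : ContDiffOn ℝ 1 g (slab T)) : ContinuousOn (slabD T a g) (slab T) :=
  (continuousOn_fderivWithin_slab hT hg).clm_apply continuousOn_const

lemma pderiv_slice {g : ℝ × E3 → ℝ} (hg : ContDiffOn ℝ 1 g (slab T)) {τ : ℝ} (hτ : τ ∈ Icc 0 T)
    (y : E3) (k : Fin 3) : pderiv k (fun x => g (τ, x)) y = slabD T (dirX k) g (τ, y) :=
  fderiv_slice hg hτ y _

/-- The slab lies in the closure of its interior, so the symmetry of second derivatives extends to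
the time faces. -/
lemma slabD_comm (hT : 0 < T) {g : ℝ × E3 → ℝ} (hg : ContDiffOn ℝ 2 g (slab T)) {p : ℝ × E3}
    (hp : p ∈ slab T) (a b : ℝ × E3) :
    slabD T a (slabD T b g) p = slabD T b (slabD T a g) p := by
  have hu := uniqueDiffOn_slab hT
  have hcl : p ∈ closure (interior (slab T)) := by
    rw [slab, interior_prod_eq, closure_prod_eq, interior_Icc, closure_Ioo hT.ne]
    simpa [slab] using hp
  have hsymm := (hg p hp).isSymmSndFDerivWithinAt (by simp) hu hcl hp
  have hd : DifferentiableWithinAt ℝ (fderivWithin ℝ g (slab T)) (slab T) p :=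
    (hg.fderivWithin hu (m := 1) (by norm_num)).differentiableOn one_ne_zero p hp
  have h : ∀ a b, slabD T a (slabD T b g) p
      = fderivWithin ℝ (fderivWithin ℝ g (slab T)) (slab T) p a b := by
    intro a b
    simp only [slabD]
    have : slabD T b g = fun p => fderivWithin ℝ g (slab T) p b := rfl
    rw [this, fderivWithin_clm_apply (hu p hp) hd (differentiableWithinAt_const b)]
    simp [fderivWithin_const_apply]
  rw [h, h]
  exact hsymm a b

lemma hasDerivAt_line {g : ℝ × E3 → ℝ} (hg : ContDiffOn ℝ 1 g (slab T)) {p : ℝ × E3}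
    (hp : p.1 ∈ Ioo 0 T) (a : ℝ × E3) :
    HasDerivAt (fun s : ℝ => g (p + s • a)) (slabD T a g p) 0 := by
  have hmem : p ∈ slab T := mem_slab.2 (Ioo_subset_Icc_self hp)
  have hn : slab T ∈ nhds p := prod_mem_nhds (Icc_mem_nhds hp.1 hp.2) Filter.univ_mem
  have h1 := (hg.differentiableOn one_ne_zero p hmem).hasFDerivWithinAt.hasFDerivAt hn
  exact h1.hasLineDerivAt a

/-- At interior times this reduces every product and chain rule on the slab to calculus in one
variable along a line. -/
lemma slabD_eq_of_hasDerivAt {g : ℝ × E3 → ℝ} (hg : ContDiffOn ℝ 1 g (slab T)) {p : ℝ × E3}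
    (hp : p.1 ∈ Ioo 0 T) {a : ℝ × E3} {d : ℝ}
    (h : HasDerivAt (fun s : ℝ => g (p + s • a)) d 0) : slabD T a g p = d :=
  (hasDerivAt_line hg hp a).unique h

lemma contDiffOn_spaceCoord (i : Fin 3) {n : WithTop ℕ∞} :
    ContDiffOn ℝ n (fun p : ℝ × E3 => p.2 i) (slab T) :=
  ((EuclideanSpace.proj i : E3 →L[ℝ] ℝ).contDiff.comp
    contDiff_snd).contDiffOn

end SlabDerivatives

/-! ### The fields of the flow -/

section Fields

variable {T α : ℝ} {θ V : ℝ → E3 → E3}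

/-- The `i`-th component of the displacement. -/
def comp (θ : ℝ → E3 → E3) (i : Fin 3) (p : ℝ × E3) : ℝ := θ p.1 p.2 i

/-- The logarithm of the Jacobian. -/
noncomputable def logJ (θ : ℝ → E3 → E3) (p : ℝ × E3) : ℝ := Real.log (scrJ (θ p.1) p.2)

/-- The relative enthalpy `-(1 + 1/α) log 𝒥 + (|η|² - |y|²)/2`. -/
noncomputable def enth (α : ℝ) (θ : ℝ → E3 → E3) (p : ℝ × E3) : ℝ :=
  -(1 + 1 / α) * logJ θ p + ∑ i, (p.2 i * comp θ i p + comp θ i p ^ 2 / 2)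

lemma contDiffOn_comp {n : WithTop ℕ∞}
    (hθ : ContDiffOn ℝ n (fun p : ℝ × E3 => θ p.1 p.2) (slab T)) (i : Fin 3) :
    ContDiffOn ℝ n (comp θ i) (slab T) :=
  (EuclideanSpace.proj i : E3 →L[ℝ] ℝ).contDiff.comp_contDiffOn hθ

variable (hT : 0 < T) (hθ : ContDiffOn ℝ 2 (fun p : ℝ × E3 => θ p.1 p.2) (slab T))

include hθ in
lemma jac_eq {p : ℝ × E3} (hp : p ∈ slab T) (i j : Fin 3) :
    jac (θ p.1) p.2 i j = slabD T (dirX j) (comp θ i) p :=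
  pderiv_slice ((contDiffOn_comp hθ i).of_le (by norm_num)) (mem_slab.1 hp) p.2 j

include hθ in
lemma Deta_eq {p : ℝ × E3} (hp : p ∈ slab T) (i j : Fin 3) :
    Deta (θ p.1) p.2 i j = (1 : M3) i j + slabD T (dirX j) (comp θ i) p := by
  have h1 := (contDiffOn_comp hθ i).of_le (show (1 : WithTop ℕ∞) ≤ 2 by norm_num)
  have h3 : DifferentiableAt ℝ (fun x : E3 => comp θ i (p.1, x)) p.2 :=
    (contDiff_slice h1 (mem_slab.1 hp)).differentiable one_ne_zero _
  have h4 : HasFDerivAt (fun x : E3 => x i)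
      (EuclideanSpace.proj i : E3 →L[ℝ] ℝ) p.2 :=
    (EuclideanSpace.proj i : E3 →L[ℝ] ℝ).hasFDerivAt
  have h5 : fderiv ℝ (fun x : E3 => x i + comp θ i (p.1, x)) p.2 (EuclideanSpace.single j 1)
      = (1 : M3) i j + fderiv ℝ (fun x : E3 => comp θ i (p.1, x)) p.2
        (EuclideanSpace.single j 1) := by
    rw [HasFDerivAt.fderiv (f := fun x : E3 => x i + comp θ i (p.1, x)) (h4.add h3.hasFDerivAt)]
    simp [Matrix.one_apply, PiLp.single_apply]
  rw [fderiv_slice h1 (mem_slab.1 hp)] at h5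
  exact h5

include hT hθ

lemma contDiffOn_Deta (i j : Fin 3) :
    ContDiffOn ℝ 1 (fun p : ℝ × E3 => Deta (θ p.1) p.2 i j) (slab T) :=
  (contDiffOn_const.add (contDiffOn_slabD hT (dirX j) (contDiffOn_comp hθ i))).congr
    fun _ hp => Deta_eq hθ hp i j

lemma contDiffOn_scrJ : ContDiffOn ℝ 1 (fun p : ℝ × E3 => scrJ (θ p.1) p.2) (slab T) :=
  contDiffOn_det (contDiffOn_Deta hT hθ)

omit hT in
lemma velocity_eq (hV : ∀ τ ∈ Icc 0 T, ∀ y, V τ y = dtime T θ τ y) (hT : 0 < T) {p : ℝ × E3}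
    (hp : p ∈ slab T) (i : Fin 3) : comp V i p = slabD T dirT (comp θ i) p := by
  have hp1 := mem_slab.1 hp
  have h1 := (contDiffOn_comp hθ i).of_le (show (1 : WithTop ℕ∞) ≤ 2 by norm_num)
  have h2 := hasDerivWithinAt_slice (hθ.of_le (show (1 : WithTop ℕ∞) ≤ 2 by norm_num)) hp1 p.2
  have h3 := (EuclideanSpace.proj i : E3 →L[ℝ] ℝ).hasFDerivAt
    |>.comp_hasDerivWithinAt p.1 h2
  have hu := uniqueDiffOn_Icc hT p.1 hp1
  have h4 := hu.eq_deriv _ h3 (hasDerivWithinAt_slice h1 hp1 p.2)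
  rw [comp, hV p.1 hp1, dtime, h2.derivWithin hu]
  exact h4

lemma contDiffOn_velocity (hV : ∀ τ ∈ Icc 0 T, ∀ y, V τ y = dtime T θ τ y) (i : Fin 3) :
    ContDiffOn ℝ 1 (comp V i) (slab T) :=
  (contDiffOn_slabD hT dirT (contDiffOn_comp hθ i)).congr
    fun _ hp => velocity_eq hθ hV hT hp i

lemma dtime_velocity (hV : ∀ τ ∈ Icc 0 T, ∀ y, V τ y = dtime T θ τ y) {p : ℝ × E3}
    (hp : p ∈ slab T) (i : Fin 3) : dtime T V p.1 p.2 i = slabD T dirT (comp V i) p := by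
  have hp1 := mem_slab.1 hp
  have hVc : ContDiffOn ℝ 1 (fun p : ℝ × E3 => V p.1 p.2) (slab T) :=
    contDiffOn_euclidean.2 fun i => contDiffOn_velocity hT hθ hV i
  have h2 := hasDerivWithinAt_slice hVc hp1 p.2
  have h3 := (EuclideanSpace.proj i : E3 →L[ℝ] ℝ).hasFDerivAt
    |>.comp_hasDerivWithinAt p.1 h2
  have hu := uniqueDiffOn_Icc hT p.1 hp1
  have h4 := hu.eq_deriv _ h3 (hasDerivWithinAt_slice (contDiffOn_velocity hT hθ hV i) hp1 p.2)
  rw [dtime, h2.derivWithin hu]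
  exact h4

lemma hasDerivAt_Deta_line {p : ℝ × E3} (hp : p.1 ∈ Ioo 0 T) (a : ℝ × E3) (i j : Fin 3) :
    HasDerivAt (fun s : ℝ => Deta (θ (p + s • a).1) (p + s • a).2 i j)
      (Matrix.of (fun i j => slabD T a (slabD T (dirX j) (comp θ i)) p) i j) 0 := by
  have h0 : p + (0 : ℝ) • a = p := by simp
  have h1 := hasDerivAt_line (contDiffOn_slabD hT (dirX j) (contDiffOn_comp hθ i)) hp a
  refine (h1.const_add ((1 : M3) i j)).congr_of_eventuallyEq ?_
  have hc : ContinuousAt (fun s : ℝ => p + s • a) 0 := by fun_prop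
  have hn : slab T ∈ nhds (p + (0 : ℝ) • a) := by
    rw [h0]; exact prod_mem_nhds (Icc_mem_nhds hp.1 hp.2) Filter.univ_mem
  filter_upwards [hc hn] with s hs
  exact Deta_eq hθ hs i j

variable (hJ : ∀ p ∈ slab T, 0 < scrJ (θ p.1) p.2)

include hJ

lemma contDiffOn_scrA (i j : Fin 3) :
    ContDiffOn ℝ 1 (fun p : ℝ × E3 => scrA (θ p.1) p.2 i j) (slab T) :=
  contDiffOn_inv (contDiffOn_Deta hT hθ) (fun p hp => (hJ p hp).ne') i j

lemma contDiffOn_logJ : ContDiffOn ℝ 1 (logJ θ) (slab T) :=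
  (contDiffOn_scrJ hT hθ).log fun p hp => (hJ p hp).ne'

lemma contDiffOn_enth : ContDiffOn ℝ 1 (enth α θ) (slab T) := by
  have h := fun i => (contDiffOn_comp hθ i).of_le (show (1 : WithTop ℕ∞) ≤ 2 by norm_num)
  exact (contDiffOn_const.mul (contDiffOn_logJ hT hθ hJ)).add <| ContDiffOn.sum fun i _ =>
    ((contDiffOn_spaceCoord i).mul (h i)).add (((h i).pow 2).div_const 2)

lemma slabD_scrA {p : ℝ × E3} (hp : p.1 ∈ Ioo 0 T) (a : ℝ × E3) (i j : Fin 3) :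
    slabD T a (fun p => scrA (θ p.1) p.2 i j) p
      = -∑ s, ∑ l, scrA (θ p.1) p.2 i l * slabD T a (slabD T (dirX s) (comp θ l)) p
          * scrA (θ p.1) p.2 s j := by
  have hmem : p ∈ slab T := mem_slab.2 (Ioo_subset_Icc_self hp)
  have h0 : p + (0 : ℝ) • a = p := by simp
  have hm := hasDerivAt_Deta_line hT hθ hp a
  have hd : (Deta (θ (p + (0 : ℝ) • a).1) (p + (0 : ℝ) • a).2).det ≠ 0 := by
    rw [h0]; exact (hJ p hmem).ne'
  have h2 := hasDerivAt_inv hm hd i j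
  rw [slabD_eq_of_hasDerivAt (contDiffOn_scrA hT hθ hJ i j) hp h2, h0]
  simp only [Matrix.mul_apply, Matrix.of_apply, Finset.sum_mul]
  rfl

lemma slabD_logJ {p : ℝ × E3} (hp : p.1 ∈ Ioo 0 T) (a : ℝ × E3) :
    slabD T a (logJ θ) p
      = ∑ k, ∑ l, scrA (θ p.1) p.2 k l * slabD T a (slabD T (dirX k) (comp θ l)) p := by
  have hmem : p ∈ slab T := mem_slab.2 (Ioo_subset_Icc_self hp)
  have h0 : p + (0 : ℝ) • a = p := by simp
  have hm := hasDerivAt_Deta_line hT hθ hp a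
  have hd : (Deta (θ (p + (0 : ℝ) • a).1) (p + (0 : ℝ) • a).2).det ≠ 0 := by
    rw [h0]; exact (hJ p hmem).ne'
  have h2 := hasDerivAt_log_det hm hd
  rw [slabD_eq_of_hasDerivAt (contDiffOn_logJ hT hθ hJ) hp h2, h0]
  rfl

lemma slabD_enth {p : ℝ × E3} (hp : p.1 ∈ Ioo 0 T) (a : ℝ × E3) :
    slabD T a (enth α θ) p = -(1 + 1 / α) * slabD T a (logJ θ) p
      + ∑ i, (a.2 i * comp θ i p + (p.2 i + comp θ i p) * slabD T a (comp θ i) p) := by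
  have h := fun i => hasDerivAt_line
    ((contDiffOn_comp hθ i).of_le (show (1 : WithTop ℕ∞) ≤ 2 by norm_num)) hp a
  have hc : ∀ i, HasDerivAt (fun s : ℝ => (p + s • a).2 i) (a.2 i) 0 := by
    intro i
    simpa using ((hasDerivAt_id (0 : ℝ)).mul_const (a.2 i)).const_add (p.2 i)
  have h1 := ((hasDerivAt_line (contDiffOn_logJ hT hθ hJ) hp a).const_mul (-(1 + 1 / α))).add
    (HasDerivAt.fun_sum (u := Finset.univ) fun i _ =>
      ((hc i).mul (h i)).add (((h i).pow 2).div_const 2))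
  rw [slabD_eq_of_hasDerivAt (contDiffOn_enth hT hθ hJ) hp h1]
  simp only [zero_smul, add_zero]
  congr 1
  refine Finset.sum_congr rfl fun i _ => ?_
  ring

/-- The Piola identity. -/
lemma sum_slabD_scrA {p : ℝ × E3} (hp : p.1 ∈ Ioo 0 T) (j : Fin 3) :
    ∑ k, slabD T (dirX k) (fun p => scrA (θ p.1) p.2 k j) p
      = -∑ s, scrA (θ p.1) p.2 s j * slabD T (dirX s) (logJ θ) p := by
  have hmem : p ∈ slab T := mem_slab.2 (Ioo_subset_Icc_self hp)
  simp only [slabD_scrA hT hθ hJ hp, slabD_logJ hT hθ hJ hp, Finset.sum_neg_distrib,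
    Finset.mul_sum]
  rw [neg_inj, Finset.sum_comm]
  refine Finset.sum_congr rfl fun s _ => Finset.sum_congr rfl fun k _ =>
    Finset.sum_congr rfl fun l _ => ?_
  -- After the exchange of $s$ and $k$ the two sides differ only in the order of the second
  -- derivatives of $\theta$.
  rw [slabD_comm hT (contDiffOn_comp hθ l) hmem (dirX k) (dirX s)]
  ring

/-- Because $\mathscr A$ inverts $D\eta$, the $\eta$-gradient of $|\eta|^2/2$ is $\eta$ itself. The
term $-|y|^2/2$ reproduces the derivative of the Gaussian weight. -/
lemma sum_scrA_mul_slabD_enth {p : ℝ × E3} (hp : p.1 ∈ Ioo 0 T) (j : Fin 3) :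
    ∑ k, scrA (θ p.1) p.2 k j * slabD T (dirX k) (enth α θ) p
      = -(1 + 1 / α) * ∑ k, scrA (θ p.1) p.2 k j * slabD T (dirX k) (logJ θ) p
        + (p.2 j + comp θ j p) - ∑ k, scrA (θ p.1) p.2 k j * p.2 k := by
  have hmem : p ∈ slab T := mem_slab.2 (Ioo_subset_Icc_self hp)
  have hinv : ∀ i, ∑ k, Deta (θ p.1) p.2 i k * scrA (θ p.1) p.2 k j = (1 : M3) i j := fun i => by
    rw [← Matrix.mul_apply, scrA, Matrix.mul_nonsing_inv _
      (isUnit_iff_ne_zero.2 (hJ p hmem).ne')]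
  simp only [Deta_eq hθ hmem] at hinv
  simp only [slabD_enth hT hθ hJ hp]
  have h0 := hinv 0
  have h1 := hinv 1
  have h2 := hinv 2
  have hj : p.2 j + comp θ j p = ∑ i, (p.2 i + comp θ i p) * (1 : M3) i j := by
    simp [Matrix.one_apply]
  rw [hj]
  simp only [Fin.sum_univ_three, dirX_snd, Matrix.one_apply, Fin.isValue, Fin.reduceEq,
    ↓reduceIte] at h0 h1 h2 ⊢
  linear_combination (p.2 0 + comp θ 0 p) * h0 + (p.2 1 + comp θ 1 p) * h1
    + (p.2 2 + comp θ 2 p) * h2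

lemma slabD_time_logJ (hV : ∀ τ ∈ Icc 0 T, ∀ y, V τ y = dtime T θ τ y) {p : ℝ × E3}
    (hp : p.1 ∈ Ioo 0 T) :
    slabD T dirT (logJ θ) p
      = ∑ k, ∑ l, scrA (θ p.1) p.2 k l * slabD T (dirX k) (comp V l) p := by
  have hmem : p ∈ slab T := mem_slab.2 (Ioo_subset_Icc_self hp)
  rw [slabD_logJ hT hθ hJ hp]
  refine Finset.sum_congr rfl fun k _ => Finset.sum_congr rfl fun l _ => ?_
  rw [slabD_comm hT (contDiffOn_comp hθ l) hmem]
  rw [slabD_congr (fun q hq => velocity_eq hθ hV hT hq l) hmem]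

/-- This replaces the continuity equation: together with the momentum equation it forms a first
order system for $(V,q)$ whose spatial coupling is symmetric after rescaling. -/
lemma slabD_time_enth (hV : ∀ τ ∈ Icc 0 T, ∀ y, V τ y = dtime T θ τ y) {p : ℝ × E3}
    (hp : p.1 ∈ Ioo 0 T) :
    slabD T dirT (enth α θ) p
      = -(1 + 1 / α) * ∑ k, ∑ l, scrA (θ p.1) p.2 k l * slabD T (dirX k) (comp V l) p
        + ∑ i, (p.2 i + comp θ i p) * comp V i p := by
  have hmem : p ∈ slab T := mem_slab.2 (Ioo_subset_Icc_self hp)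
  rw [slabD_enth hT hθ hJ hp, slabD_time_logJ hT hθ hJ hV hp]
  congr 1
  refine Finset.sum_congr rfl fun i _ => ?_
  rw [velocity_eq hθ hV hT hmem i]
  simp [dirT]

end Fields

/-! ### The equation outside the support of `β` -/

lemma hasFDerivAt_w (y : E3) : HasFDerivAt w (-(w y) • innerSL ℝ y) y := by
  have h1 : HasFDerivAt (fun x : E3 => -(‖x‖ ^ 2 / 2)) (-innerSL ℝ y) y := by
    have h2 : HasFDerivAt (fun x : E3 => ‖x‖ ^ 2) (2 • innerSL ℝ y) y :=
      (hasStrictFDerivAt_norm_sq y).hasFDerivAt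
    have h3 : HasFDerivAt (fun x : E3 => -(‖x‖ ^ 2 * 2⁻¹)) _ y := (h2.mul_const (2⁻¹ : ℝ)).neg
    simp only [div_eq_mul_inv]
    exact h3.congr_fderiv (by ext v; simp)
  have h : HasFDerivAt w _ y := h1.exp
  exact h.congr_fderiv (by ext v; simp [w])

lemma pderiv_w (y : E3) (k : Fin 3) : pderiv k w y = -(y k * w y) := by
  rw [pderiv, (hasFDerivAt_w y).fderiv]
  simp [EuclideanSpace.inner_single_right, mul_comm]

lemma pderiv_weighted_flux {a l : E3 → ℝ} {y : E3} (ha : DifferentiableAt ℝ a y)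
    (hl : DifferentiableAt ℝ l y) (k : Fin 3) (c d r : ℝ) :
    pderiv k (fun x => w x * c * (a x * Real.exp (-(r * l x)) - d)) y
      = w y * c * (-(y k * (a y * Real.exp (-(r * l y)) - d))
        + Real.exp (-(r * l y)) * (pderiv k a y - r * a y * pderiv k l y)) := by
  have he : HasFDerivAt (fun x => Real.exp (-(r * l x))) _ y :=
    (hl.hasFDerivAt.const_mul r).neg.exp
  have hz : HasFDerivAt (fun x => a x * Real.exp (-(r * l x)) - d) _ y :=
    (ha.hasFDerivAt.mul he).sub_const d
  have h : HasFDerivAt (fun x => w x * c * (a x * Real.exp (-(r * l x)) - d)) _ y :=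
    ((hasFDerivAt_w y).mul_const c).mul hz
  have hw : fderiv ℝ w y (EuclideanSpace.single k 1) = -(y k * w y) := pderiv_w y k
  rw [(hasFDerivAt_w y).fderiv] at hw
  rw [pderiv, pderiv, pderiv, h.fderiv]
  simp only [_root_.add_apply, _root_.smul_apply, _root_.neg_apply, Pi.neg_apply,
    smul_eq_mul] at hw ⊢
  linear_combination c * (a y * Real.exp (-(r * l y)) - d) * hw

section Exterior

variable {T α σ : ℝ} {θ V : ℝ → E3 → E3} {β : E3 → ℝ} {B : AffineMotion α}

/-- Where $\beta=0$, dividing the flux derivative by $w$ leaves $-y_k(\mathscr A^k_j\mathscr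
J^{-1/\alpha}-\delta^k_j)$ and derivatives of $\mathscr A$ and $\mathscr J$. The Piola identity
turns the latter into $\nabla\log\mathscr J$ with the factor $1+1/\alpha$, and with $\theta_j$ added
the sum is a gradient of $q$ plus a term of order zero. -/
lemma exterior_equation (hT : 0 < T) (hsol : IsSolution B σ β T θ V)
    (hJ : ∀ p ∈ slab T, 0 < scrJ (θ p.1) p.2) (hβ : tsupport β ⊆ Metric.closedBall 0 1)
    {p : ℝ × E3} (hp : p.1 ∈ Ioo 0 T) (hy : 1 < ‖p.2‖) (i : Fin 3) :
    B.mu p.1 ^ σ * slabD T dirT (comp V i) p + B.muDot p.1 * B.mu p.1 ^ (-1 + σ) * comp V i p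
      + 2 * B.mu p.1 ^ σ * ∑ j, B.Gam p.1 i j * comp V j p
      + B.Cbar * B.mu p.1 ^ (-(3 / α - σ)) * ∑ j, B.Lam p.1 i j *
        (Real.exp (-(1 / α * logJ θ p))
            * ∑ k, scrA (θ p.1) p.2 k j * slabD T (dirX k) (enth α θ) p
          + (1 - Real.exp (-(1 / α * logJ θ p))) * (p.2 j + comp θ j p)) = 0 := by
  have hθ : ContDiffOn ℝ 2 (fun p : ℝ × E3 => θ p.1 p.2) (slab T) := hsol.contDiff
  have hp' := Ioo_subset_Icc_self hp
  have hmem : p ∈ slab T := mem_slab.2 hp'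
  have hβ0 : ∀ᶠ x in nhds p.2, β x = 0 := by
    have : p.2 ∉ tsupport β := fun h => by
      have := hβ h
      rw [mem_closedBall_zero_iff] at this
      linarith
    exact notMem_tsupport_iff_eventuallyEq.1 this
  have hpow : ∀ x, scrJ (θ p.1) x ^ (-(1 / α)) = Real.exp (-(1 / α * logJ θ (p.1, x))) := by
    intro x
    rw [Real.rpow_def_of_pos (hJ (p.1, x) (mem_slab.2 hp'))]
    simp only [logJ]
    ring_nf
  have hA : ∀ k j, DifferentiableAt ℝ (fun x => scrA (θ p.1) x k j) p.2 := fun k j =>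
    (contDiff_slice (contDiffOn_scrA hT hθ hJ k j) hp').differentiable one_ne_zero _
  have hL : DifferentiableAt ℝ (fun x => logJ θ (p.1, x)) p.2 :=
    (contDiff_slice (contDiffOn_logJ hT hθ hJ) hp').differentiable one_ne_zero _
  have hAk : ∀ k j, pderiv k (fun x => scrA (θ p.1) x k j) p.2
      = slabD T (dirX k) (fun p => scrA (θ p.1) p.2 k j) p := fun k j =>
    pderiv_slice (contDiffOn_scrA hT hθ hJ k j) hp' p.2 k
  have hLk : ∀ k, pderiv k (fun x => logJ θ (p.1, x)) p.2 = slabD T (dirX k) (logJ θ) p :=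
    fun k => pderiv_slice (contDiffOn_logJ hT hθ hJ) hp' p.2 k
  have hflux : ∀ k, pderiv k (fun x => ∑ j, w x * B.Lam p.1 i j * (1 + β x) *
      (scrA (θ p.1) x k j * scrJ (θ p.1) x ^ (-(1 / α)) - (1 : M3) k j)) p.2
      = ∑ j, w p.2 * B.Lam p.1 i j * (-(p.2 k * (scrA (θ p.1) p.2 k j *
          Real.exp (-(1 / α * logJ θ p)) - (1 : M3) k j)) + Real.exp (-(1 / α * logJ θ p)) *
          (slabD T (dirX k) (fun p => scrA (θ p.1) p.2 k j) p
            - 1 / α * scrA (θ p.1) p.2 k j * slabD T (dirX k) (logJ θ) p)) := by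
    intro k
    have h1 : (fun x => ∑ j, w x * B.Lam p.1 i j * (1 + β x) *
        (scrA (θ p.1) x k j * scrJ (θ p.1) x ^ (-(1 / α)) - (1 : M3) k j)) =ᶠ[nhds p.2]
        fun x => ∑ j, w x * B.Lam p.1 i j * (scrA (θ p.1) x k j *
          Real.exp (-(1 / α * logJ θ (p.1, x))) - (1 : M3) k j) := by
      filter_upwards [hβ0] with x hx
      simp only [hx, hpow, add_zero, mul_one]
    have h2 : ∀ j, DifferentiableAt ℝ (fun x => w x * B.Lam p.1 i j * (scrA (θ p.1) x k j *
          Real.exp (-(1 / α * logJ θ (p.1, x))) - (1 : M3) k j)) p.2 := fun j =>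
      ((hasFDerivAt_w p.2).differentiableAt.mul_const _).mul
        (((hA k j).mul (hL.const_mul _).neg.exp).sub_const _)
    rw [pderiv, h1.fderiv_eq, fderiv_fun_sum fun j _ => h2 j, _root_.sum_apply]
    refine Finset.sum_congr rfl fun j _ => ?_
    have := pderiv_weighted_flux (hA k j) hL k (B.Lam p.1 i j) ((1 : M3) k j) (1 / α)
    rw [hAk, hLk] at this
    exact this
  have hforce : ∀ k, pderiv k (fun x => w x * β x) p.2 = 0 := by
    intro k
    have h1 : (fun x => w x * β x) =ᶠ[nhds p.2] fun _ => 0 := by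
      filter_upwards [hβ0] with x hx
      simp [hx]
    rw [pderiv, h1.fderiv_eq]
    simp
  have hX : ∀ j, Real.exp (-(1 / α * logJ θ p))
        * ∑ k, scrA (θ p.1) p.2 k j * slabD T (dirX k) (enth α θ) p
        + (1 - Real.exp (-(1 / α * logJ θ p))) * (p.2 j + comp θ j p)
      = comp θ j p + ∑ k, (-(p.2 k * (scrA (θ p.1) p.2 k j *
          Real.exp (-(1 / α * logJ θ p)) - (1 : M3) k j)) + Real.exp (-(1 / α * logJ θ p)) *
          (slabD T (dirX k) (fun p => scrA (θ p.1) p.2 k j) p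
            - 1 / α * scrA (θ p.1) p.2 k j * slabD T (dirX k) (logJ θ) p)) := by
    intro j
    have h1 := sum_scrA_mul_slabD_enth (α := α) hT hθ hJ hp j
    have h2 := sum_slabD_scrA hT hθ hJ hp j
    have h3 : p.2 j = ∑ k, p.2 k * (1 : M3) k j := by simp [Matrix.one_apply]
    rw [h1]
    simp only [Fin.sum_univ_three] at h2 h3 ⊢
    linear_combination h3 - Real.exp (-(1 / α * logJ θ p)) * h2
  have heq := hsol.equation p.1 hp' p.2 i
  rw [dtime_velocity hT hθ hsol.velocity hmem i] at heq
  simp only [hflux, hforce, mul_zero, Finset.sum_const_zero, add_zero] at heq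
  simp only [hX]
  have hw : w p.2 ≠ 0 := (Real.exp_pos _).ne'
  obtain ⟨G, hG⟩ : ∃ G : Fin 3 → Fin 3 → ℝ, ∀ k j, -(p.2 k * (scrA (θ p.1) p.2 k j *
      Real.exp (-(1 / α * logJ θ p)) - (1 : M3) k j)) + Real.exp (-(1 / α * logJ θ p)) *
      (slabD T (dirX k) (fun p => scrA (θ p.1) p.2 k j) p
        - 1 / α * scrA (θ p.1) p.2 k j * slabD T (dirX k) (logJ θ) p) = G k j :=
    ⟨_, fun _ _ => rfl⟩
  simp only [hG] at heq ⊢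
  rw [← heq]
  simp only [comp, Fin.sum_univ_three]
  field_simp
  ring

end Exterior

/-! ### Pointwise bounds from the a priori assumptions -/

/-- For continuous $f$ the set where the bound fails is open and null, hence empty. -/
lemma abs_le_of_eLpNorm_top_lt {f : E3 → ℝ} (hf : Continuous f) {c : ℝ} (hc : 0 ≤ c)
    (h : eLpNorm f ⊤ volume < ENNReal.ofReal c) (y : E3) : |f y| ≤ c := by
  have h1 : ∀ᵐ y, |f y| ≤ c := by
    filter_upwards [ae_le_eLpNormEssSup (f := f) (μ := volume)] with y hy
    rw [eLpNorm_exponent_top] at h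
    have h2 := hy.trans h.le
    rw [← Real.norm_eq_abs]
    rwa [← ofReal_norm, ENNReal.ofReal_le_ofReal_iff hc] at h2
  by_contra hne
  have ho : IsOpen {y | c < |f y|} := isOpen_lt continuous_const hf.abs
  have h0 : volume {y | c < |f y|} = 0 := by
    have := ae_iff.1 h1
    simpa using this
  have := (ho.measure_eq_zero_iff volume).1 h0
  exact (this ▸ (not_le.1 hne : y ∈ {y | c < |f y|}) : y ∈ (∅ : Set E3))

section Bounds

variable {T α σ C : ℝ} {N : ℕ} {θ V : ℝ → E3 → E3} {B : AffineMotion α}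

lemma abs_scrJ_sub_one_le (hT : 0 < T)
    (hθ : ContDiffOn ℝ 2 (fun p : ℝ × E3 => θ p.1 p.2) (slab T))
    (h : APriori B N σ C T θ V) {p : ℝ × E3} (hp : p ∈ slab T) :
    |scrJ (θ p.1) p.2 - 1| ≤ 1 / 3 :=
  abs_le_of_eLpNorm_top_lt ((contDiff_slice (contDiffOn_scrJ hT hθ)
    (mem_slab.1 hp)).continuous.sub continuous_const) (by norm_num)
    (h.scrJ_bound p.1 (mem_slab.1 hp)) p.2

lemma abs_scrA_le (hT : 0 < T)
    (hθ : ContDiffOn ℝ 2 (fun p : ℝ × E3 => θ p.1 p.2) (slab T))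
    (h : APriori B N σ C T θ V) (hJ : ∀ p ∈ slab T, 0 < scrJ (θ p.1) p.2)
    {p : ℝ × E3} (hp : p ∈ slab T) (i j : Fin 3) : |scrA (θ p.1) p.2 i j| ≤ 4 / 3 := by
  have h1 : eLpNorm (fun y => (scrA (θ p.1) y - 1) i j) ⊤ volume < ENNReal.ofReal (1 / 3) :=
    lt_of_le_of_lt (le_iSup₂ (f := fun i j => eLpNorm (fun y => (scrA (θ p.1) y - 1) i j) ⊤ volume)
      i j) (h.scrA_bound p.1 (mem_slab.1 hp))
  have h2 : |scrA (θ p.1) p.2 i j - (1 : M3) i j| ≤ 1 / 3 :=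
    abs_le_of_eLpNorm_top_lt ((contDiff_slice (contDiffOn_scrA hT hθ hJ i j)
    (mem_slab.1 hp)).continuous.sub continuous_const) (by norm_num) h1 p.2
  have h3 : |(1 : M3) i j| ≤ 1 := by
    rw [Matrix.one_apply]; split_ifs <;> simp
  have h4 : scrA (θ p.1) p.2 i j = (scrA (θ p.1) p.2 i j - (1 : M3) i j) + (1 : M3) i j := by ring
  rw [h4]
  refine (abs_add_le _ _).trans ?_
  linarith

end Bounds

/-! ### The energy -/

section EnergyDensity

variable {T α : ℝ} {θ V : ℝ → E3 → E3} {S D : ℝ → M3}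

/-- The energy density of the exterior equation, symmetrized by `S`. -/
noncomputable def energy (α : ℝ) (S : ℝ → M3) (θ V : ℝ → E3 → E3) (p : ℝ × E3) : ℝ :=
  Real.exp (1 / α * logJ θ p) / 2 * ∑ i, ∑ j, comp V i p * S p.1 i j * comp V j p
    + α / (1 + α) / 2 * enth α θ p ^ 2 + (∑ i, comp θ i p ^ 2) / 2

/-- The energy flux. -/
noncomputable def flux (α : ℝ) (θ V : ℝ → E3 → E3) (k : Fin 3) (p : ℝ × E3) : ℝ :=
  enth α θ p * ∑ j, scrA (θ p.1) p.2 k j * comp V j p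

/-- The sum of the squares of velocity, relative enthalpy and displacement. -/
noncomputable def sqSum (α : ℝ) (θ V : ℝ → E3 → E3) (p : ℝ × E3) : ℝ :=
  ∑ i, comp V i p ^ 2 + enth α θ p ^ 2 + ∑ i, comp θ i p ^ 2

lemma sqSum_nonneg (p : ℝ × E3) : 0 ≤ sqSum α θ V p := by
  unfold sqSum; positivity

lemma comp_velocity_sq_le (i : Fin 3) (p : ℝ × E3) : comp V i p ^ 2 ≤ sqSum α θ V p := by
  have h1 := Finset.single_le_sum (f := fun i => comp V i p ^ 2)
    (fun i _ => sq_nonneg _) (Finset.mem_univ i)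
  have h2 : 0 ≤ ∑ i, comp θ i p ^ 2 := Finset.sum_nonneg fun i _ => sq_nonneg _
  have h3 := sq_nonneg (enth α θ p)
  simp only [sqSum] at *
  linarith

lemma comp_sq_le (i : Fin 3) (p : ℝ × E3) : comp θ i p ^ 2 ≤ sqSum α θ V p := by
  have h1 := Finset.single_le_sum (f := fun i => comp θ i p ^ 2)
    (fun i _ => sq_nonneg _) (Finset.mem_univ i)
  have h2 : 0 ≤ ∑ i, comp V i p ^ 2 := Finset.sum_nonneg fun i _ => sq_nonneg _
  have h3 := sq_nonneg (enth α θ p)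
  simp only [sqSum] at *
  linarith

lemma enth_sq_le (p : ℝ × E3) : enth α θ p ^ 2 ≤ sqSum α θ V p := by
  have h1 : 0 ≤ ∑ i, comp θ i p ^ 2 := Finset.sum_nonneg fun i _ => sq_nonneg _
  have h2 : 0 ≤ ∑ i, comp V i p ^ 2 := Finset.sum_nonneg fun i _ => sq_nonneg _
  simp only [sqSum]
  linarith

lemma abs_mul_le_of_sq_le {a b Q : ℝ} (ha : a ^ 2 ≤ Q) (hb : b ^ 2 ≤ Q) : |a| * |b| ≤ Q := by
  nlinarith [sq_nonneg (|a| - |b|), sq_abs a, sq_abs b]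

lemma abs_exp_sub_one_le (x : ℝ) : |Real.exp x - 1| ≤ |x| * (Real.exp x + 1) := by
  have h1 := Real.add_one_le_exp x
  have h2 := Real.add_one_le_exp (-x)
  have h3 : Real.exp (-x) * Real.exp x = 1 := by rw [← Real.exp_add]; simp
  have h4 := Real.exp_pos x
  have h5 := mul_le_mul_of_nonneg_right h2 h4.le
  rw [h3] at h5
  have h6 := le_abs_self x
  have h7 := neg_abs_le x
  have h8 := mul_le_mul_of_nonneg_right h6 h4.le
  have h9 := mul_nonneg (abs_nonneg x) h4.le
  rw [abs_le]
  constructor <;> nlinarith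

variable (hT : 0 < T) (hθ : ContDiffOn ℝ 2 (fun p : ℝ × E3 => θ p.1 p.2) (slab T))
  (hV : ∀ τ ∈ Icc 0 T, ∀ y, V τ y = dtime T θ τ y)
  (hJ : ∀ p ∈ slab T, 0 < scrJ (θ p.1) p.2)
  (hS : ∀ i j, ContDiffOn ℝ 1 (fun τ => S τ i j) (Icc 0 T))

lemma contDiffOn_fst_slab {g : ℝ → ℝ} (hg : ContDiffOn ℝ 1 g (Icc 0 T)) :
    ContDiffOn ℝ 1 (fun p : ℝ × E3 => g p.1) (slab T) :=
  hg.comp contDiffOn_fst fun _ hp => mem_slab.1 hp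

include hT hθ hV hJ

lemma contDiffOn_flux (k : Fin 3) : ContDiffOn ℝ 1 (flux α θ V k) (slab T) :=
  (contDiffOn_enth hT hθ hJ).mul <| ContDiffOn.sum fun j _ =>
    (contDiffOn_scrA hT hθ hJ k j).mul (contDiffOn_velocity hT hθ hV j)

lemma slabD_flux {p : ℝ × E3} (hp : p.1 ∈ Ioo 0 T) (k : Fin 3) (a : ℝ × E3) :
    slabD T a (flux α θ V k) p
      = slabD T a (enth α θ) p * ∑ j, scrA (θ p.1) p.2 k j * comp V j p
        + enth α θ p * ∑ j, (slabD T a (fun p => scrA (θ p.1) p.2 k j) p * comp V j p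
            + scrA (θ p.1) p.2 k j * slabD T a (comp V j) p) := by
  have h := (hasDerivAt_line (contDiffOn_enth (α := α) hT hθ hJ) hp a).mul
    (HasDerivAt.fun_sum (u := Finset.univ) fun j _ =>
      (hasDerivAt_line (contDiffOn_scrA hT hθ hJ k j) hp a).mul
        (hasDerivAt_line (contDiffOn_velocity hT hθ hV j) hp a))
  rw [slabD_eq_of_hasDerivAt (contDiffOn_flux hT hθ hV hJ k) hp h]
  simp only [zero_smul, add_zero, Pi.mul_apply]

include hS

lemma contDiffOn_energy : ContDiffOn ℝ 1 (energy α S θ V) (slab T) := by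
  have hv := contDiffOn_velocity hT hθ hV
  have h := fun i => (contDiffOn_comp hθ i).of_le (show (1 : WithTop ℕ∞) ≤ 2 by norm_num)
  refine ContDiffOn.add (ContDiffOn.add (ContDiffOn.mul ?_ ?_) ?_) ?_
  · exact (contDiffOn_const.mul (contDiffOn_logJ hT hθ hJ)).exp.div_const 2
  · exact ContDiffOn.sum fun i _ => ContDiffOn.sum fun j _ =>
      ((hv i).mul (contDiffOn_fst_slab (hS i j))).mul (hv j)
  · exact contDiffOn_const.mul ((contDiffOn_enth hT hθ hJ).pow 2)
  · exact (ContDiffOn.sum fun i _ => (h i).pow 2).div_const 2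

lemma slabD_energy (hsymm : ∀ τ i j, S τ i j = S τ j i) {p : ℝ × E3} (hp : p.1 ∈ Ioo 0 T)
    (a : ℝ × E3) :
    slabD T a (energy α S θ V) p
      = Real.exp (1 / α * logJ θ p) / 2 * (1 / α * slabD T a (logJ θ) p)
          * ∑ i, ∑ j, comp V i p * S p.1 i j * comp V j p
        + Real.exp (1 / α * logJ θ p) / 2
          * ∑ i, ∑ j, comp V i p * slabD T a (fun p => S p.1 i j) p * comp V j p
        + Real.exp (1 / α * logJ θ p)
          * ∑ i, comp V i p * ∑ j, S p.1 i j * slabD T a (comp V j) p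
        + α / (1 + α) * enth α θ p * slabD T a (enth α θ) p
        + ∑ i, comp θ i p * slabD T a (comp θ i) p := by
  have hv := fun i => hasDerivAt_line (contDiffOn_velocity hT hθ hV i) hp a
  have h1 := fun i => hasDerivAt_line
    ((contDiffOn_comp hθ i).of_le (show (1 : WithTop ℕ∞) ≤ 2 by norm_num)) hp a
  have h := (((((hasDerivAt_line (contDiffOn_logJ hT hθ hJ) hp a).const_mul
      (1 / α)).exp.div_const 2).mul
    (HasDerivAt.fun_sum (u := Finset.univ) fun i _ => HasDerivAt.fun_sum (u := Finset.univ)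
      fun j _ => ((hv i).mul (hasDerivAt_line (contDiffOn_fst_slab (hS i j)) hp a)).mul
        (hv j))).add
    (((hasDerivAt_line (contDiffOn_enth (α := α) hT hθ hJ) hp a).pow 2).const_mul
      (α / (1 + α) / 2))).add
    ((HasDerivAt.fun_sum (u := Finset.univ) fun i _ => (h1 i).pow 2).div_const 2)
  rw [slabD_eq_of_hasDerivAt (contDiffOn_energy hT hθ hV hJ hS) hp h]
  have s1 := hsymm p.1 0 1
  have s2 := hsymm p.1 0 2
  have s3 := hsymm p.1 1 2
  simp only [zero_smul, add_zero, Pi.mul_apply, Fin.sum_univ_three, s1, s2, s3]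
  ring

/-- The energy identity. -/
lemma energy_identity (hα : 0 < α) (hsymm : ∀ τ i j, S τ i j = S τ j i) {p : ℝ × E3}
    (hp : p.1 ∈ Ioo 0 T)
    (heq : ∀ i, ∑ j, S p.1 i j * slabD T dirT (comp V j) p + ∑ j, D p.1 i j * comp V j p
      + (Real.exp (-(1 / α * logJ θ p))
            * ∑ k, scrA (θ p.1) p.2 k i * slabD T (dirX k) (enth α θ) p
          + (1 - Real.exp (-(1 / α * logJ θ p))) * (p.2 i + comp θ i p)) = 0) :
    slabD T dirT (energy α S θ V) p + ∑ k, slabD T (dirX k) (flux α θ V k) p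
      = ∑ i, ∑ j, comp V i p * (Real.exp (1 / α * logJ θ p) * (
          1 / α * slabD T dirT (logJ θ) p / 2 * S p.1 i j
          + slabD T dirT (fun p => S p.1 i j) p / 2 - D p.1 i j)) * comp V j p
        + ∑ j, enth α θ p * (α / (1 + α) * (p.2 j + comp θ j p)
            + ∑ k, slabD T (dirX k) (fun p => scrA (θ p.1) p.2 k j) p) * comp V j p
        + ∑ j, comp θ j p * comp V j p
        - (Real.exp (1 / α * logJ θ p) - 1) * ∑ j, (p.2 j + comp θ j p) * comp V j p := by
  have hmem : p ∈ slab T := mem_slab.2 (Ioo_subset_Icc_self hp)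
  rw [slabD_energy hT hθ hV hJ hS hsymm hp]
  simp only [slabD_flux hT hθ hV hJ hp]
  have hsv : ∀ i, ∑ j, S p.1 i j * slabD T dirT (comp V j) p = - ∑ j, D p.1 i j * comp V j p
      - (Real.exp (-(1 / α * logJ θ p))
            * ∑ k, scrA (θ p.1) p.2 k i * slabD T (dirX k) (enth α θ) p
          + (1 - Real.exp (-(1 / α * logJ θ p))) * (p.2 i + comp θ i p)) := fun i => by
    linarith [heq i]
  have hq := slabD_time_enth (α := α) hT hθ hJ hV hp
  -- These two cancellations dictate the weights in the energy: $\mathscr J^{1/\alpha}$ removes the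
  -- factor of $\nabla q$ in the momentum equation, and $\alpha/(1+\alpha)$ the factor of $\nabla V$
  -- in $\partial_\tau q$.
  have hexp : Real.exp (1 / α * logJ θ p) * Real.exp (-(1 / α * logJ θ p)) = 1 := by
    rw [← Real.exp_add]; simp
  have hb : α / (1 + α) * (1 + 1 / α) = 1 := by field_simp; ring
  have hth := fun i => velocity_eq hθ hV hT hmem i
  simp only [hsv, hq, ← hth]
  generalize slabD T dirT (logJ θ) p = Lt
  generalize Real.exp (1 / α * logJ θ p) = E at *
  generalize Real.exp (-(1 / α * logJ θ p)) = Z at *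
  generalize hbb : α / (1 + α) = b at *
  generalize hcc : 1 / α = c at *
  generalize enth α θ p = q at *
  have hX := congrArg (fun z => z * ∑ i, comp V i p *
    (∑ k, scrA (θ p.1) p.2 k i * slabD T (dirX k) (enth α θ) p - (p.2 i + comp θ i p))) hexp
  have hW := congrArg (fun z => z * (q * ∑ k, ∑ l, scrA (θ p.1) p.2 k l
    * slabD T (dirX k) (comp V l) p)) hb
  simp only [Fin.sum_univ_three] at hX hW ⊢
  linear_combination -hX - hW

end EnergyDensity

/-! ### Coercivity, flux speed and production of the energy -/

section EnergyEstimate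

variable {T α : ℝ} {θ V : ℝ → E3 → E3} {S D : ℝ → M3}

lemma exists_bound_slab_family {ι : Type*} [Fintype ι] {g : ι → ℝ × E3 → ℝ}
    (hg : ∀ i, ContinuousOn (g i) (slab T)) (y₀ : E3) (R : ℝ) :
    ∃ M, 0 ≤ M ∧ ∀ i, ∀ p ∈ slab T, p.2 ∈ Metric.closedBall y₀ R → |g i p| ≤ M := by
  choose M hM0 hM using fun i => exists_bound_slab (hg i) y₀ R
  refine ⟨∑ i, M i, Finset.sum_nonneg fun i _ => hM0 i, fun i p hp hy => ?_⟩
  exact (hM i p.1 (mem_slab.1 hp) p.2 hy).trans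
    (Finset.single_le_sum (fun i _ => hM0 i) (Finset.mem_univ i))

lemma mul_mul_le_of_sq_le {a b g m Q : ℝ} (ha : a ^ 2 ≤ Q) (hb : b ^ 2 ≤ Q) (hg : |g| ≤ m) :
    a * g * b ≤ m * Q := by
  have h1 := abs_mul_le_of_sq_le ha hb
  have h2 : 0 ≤ m := (abs_nonneg g).trans hg
  calc a * g * b ≤ |a * g * b| := le_abs_self _
    _ = |g| * (|a| * |b|) := by rw [abs_mul, abs_mul]; ring
    _ ≤ m * Q := by gcongr

lemma energy_coercive {J₀ c : ℝ} (hα : 0 < α) (hJ₀ : 0 < J₀)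
    (hJ : ∀ p ∈ slab T, J₀ ≤ scrJ (θ p.1) p.2) (hc : 0 < c)
    (hcoer : ∀ τ ∈ Icc 0 T, ∀ v : Fin 3 → ℝ, c * ∑ i, v i ^ 2 ≤ ∑ i, ∑ j, v i * S τ i j * v j) :
    ∃ c₀, 0 < c₀ ∧ ∀ p ∈ slab T, c₀ * sqSum α θ V p ≤ energy α S θ V p := by
  set E₀ := Real.exp (1 / α * Real.log J₀) with hE₀
  have hE₀p : 0 < E₀ := Real.exp_pos _
  have hb : 0 < α / (1 + α) := by positivity
  refine ⟨min (E₀ * c / 2) (min (α / (1 + α) / 2) (1 / 2)), by positivity, fun p hp => ?_⟩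
  have h1 : E₀ ≤ Real.exp (1 / α * logJ θ p) := by
    refine Real.exp_le_exp.2 (mul_le_mul_of_nonneg_left ?_ (by positivity))
    exact Real.log_le_log hJ₀ (hJ p hp)
  have h2 := hcoer p.1 (mem_slab.1 hp) fun i => comp V i p
  have hV0 : 0 ≤ ∑ i, comp V i p ^ 2 := Finset.sum_nonneg fun i _ => sq_nonneg _
  have hth0 : 0 ≤ ∑ i, comp θ i p ^ 2 := Finset.sum_nonneg fun i _ => sq_nonneg _
  have h3 : E₀ * c / 2 * ∑ i, comp V i p ^ 2 ≤ Real.exp (1 / α * logJ θ p) / 2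
      * ∑ i, ∑ j, comp V i p * S p.1 i j * comp V j p := by
    calc E₀ * c / 2 * ∑ i, comp V i p ^ 2 = E₀ / 2 * (c * ∑ i, comp V i p ^ 2) := by ring
      _ ≤ _ := by gcongr
  unfold energy sqSum
  rw [mul_add, mul_add]
  refine add_le_add (add_le_add ?_ ?_) ?_
  · exact (mul_le_mul_of_nonneg_right (min_le_left _ _) hV0).trans h3
  · exact mul_le_mul_of_nonneg_right ((min_le_right _ _).trans (min_le_left _ _)) (sq_nonneg _)
  · refine (mul_le_mul_of_nonneg_right ((min_le_right _ _).trans (min_le_right _ _))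
      hth0).trans (le_of_eq ?_)
    ring

/-- The flux is bilinear in $q$ and $V$ with coefficients $\mathscr A$; the factor 9 counts the
pairs $(k,j)$. Compared with coercivity, this bound fixes the propagation speed. -/
lemma abs_sum_mul_flux_le {a : ℝ} {p : ℝ × E3} (hA : ∀ i j, |scrA (θ p.1) p.2 i j| ≤ a) (v : E3) :
    |∑ k, v k * flux α θ V k p| ≤ 9 * a * ‖v‖ * sqSum α θ V p := by
  have h : ∀ k j, |v k * (enth α θ p * (scrA (θ p.1) p.2 k j * comp V j p))|
      ≤ a * ‖v‖ * sqSum α θ V p := fun k j => by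
    have h1 := abs_mul_le_of_sq_le (enth_sq_le (V := V) p) (comp_velocity_sq_le (α := α) (θ := θ) j p)
    have h2 : |v k| ≤ ‖v‖ := PiLp.norm_apply_le v k
    have h3 : 0 ≤ a := (abs_nonneg _).trans (hA k j)
    have h4 := hA k j
    calc |v k * (enth α θ p * (scrA (θ p.1) p.2 k j * comp V j p))|
        = |scrA (θ p.1) p.2 k j| * |v k| * (|enth α θ p| * |comp V j p|) := by
          simp only [abs_mul]; ring
      _ ≤ a * ‖v‖ * sqSum α θ V p := by gcongr
  have h1 : ∑ k, v k * flux α θ V k p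
      = ∑ k, ∑ j, v k * (enth α θ p * (scrA (θ p.1) p.2 k j * comp V j p)) := by
    simp only [flux, Finset.mul_sum]
  rw [h1]
  refine (Finset.abs_sum_le_sum_abs _ _).trans ?_
  refine (Finset.sum_le_sum fun k _ => (Finset.abs_sum_le_sum_abs _ _).trans
    (Finset.sum_le_sum fun j _ => h k j)).trans (le_of_eq ?_)
  simp
  ring

variable (hT : 0 < T) (hθ : ContDiffOn ℝ 2 (fun p : ℝ × E3 => θ p.1 p.2) (slab T))
  (hV : ∀ τ ∈ Icc 0 T, ∀ y, V τ y = dtime T θ τ y)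
  (hJ : ∀ p ∈ slab T, 0 < scrJ (θ p.1) p.2)
  (hS : ∀ i j, ContDiffOn ℝ 1 (fun τ => S τ i j) (Icc 0 T))
  (hD : ∀ i j, ContinuousOn (fun τ => D τ i j) (Icc 0 T))

include hT hθ hJ in
/-- On bounded sets the temperature perturbation is controlled by enthalpy and displacement. -/
lemma exists_temperature_bound (hα : 0 < α) (y₀ : E3) (R : ℝ) :
    ∃ M, 0 ≤ M ∧ ∀ p ∈ slab T, p.2 ∈ Metric.closedBall y₀ R →
      |Real.exp (1 / α * logJ θ p) - 1| ≤ M * (|enth α θ p| + ∑ i, |comp θ i p|) := by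
  have hθ1 := fun i => (contDiffOn_comp hθ i).of_le (show (1 : WithTop ℕ∞) ≤ 2 by norm_num)
  obtain ⟨m, hm0, hm⟩ := exists_bound_slab_family (ι := Fin 3)
    (g := fun i p => p.2 i + comp θ i p / 2) (fun i =>
      ((contDiffOn_spaceCoord i).add ((hθ1 i).div_const 2)).continuousOn) y₀ R
  obtain ⟨n, hn0, hn⟩ := exists_bound_slab_family (ι := Unit)
    (g := fun _ p => Real.exp (1 / α * logJ θ p) + 1) (fun _ =>
      ((contDiffOn_const.mul (contDiffOn_logJ hT hθ hJ)).exp.add contDiffOn_const).continuousOn) y₀ R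
  refine ⟨1 / (1 + α) * n * (1 + m), by positivity, fun p hp hy => ?_⟩
  -- The definition of $q$ is solved for $\log\mathscr J$, which becomes linear in $q$ and $\theta$
  -- with coefficients bounded on the ball.
  have hL : 1 / α * logJ θ p
      = 1 / (1 + α) * (-enth α θ p + ∑ i, comp θ i p * (p.2 i + comp θ i p / 2)) := by
    have : ∑ i, (p.2 i * comp θ i p + comp θ i p ^ 2 / 2)
        = ∑ i, comp θ i p * (p.2 i + comp θ i p / 2) :=
      Finset.sum_congr rfl fun i _ => by ring
    rw [enth, this]
    field_simp
    ring_nf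
  have hsum : |∑ i, comp θ i p * (p.2 i + comp θ i p / 2)| ≤ m * ∑ i, |comp θ i p| := by
    rw [Finset.mul_sum]
    refine (Finset.abs_sum_le_sum_abs _ _).trans (Finset.sum_le_sum fun i _ => ?_)
    rw [abs_mul, mul_comm]
    exact mul_le_mul_of_nonneg_right (hm i p hp hy) (abs_nonneg _)
  have hs0 : 0 ≤ ∑ i, |comp θ i p| := Finset.sum_nonneg fun i _ => abs_nonneg _
  have hLabs : |1 / α * logJ θ p| ≤ 1 / (1 + α) * ((1 + m) * (|enth α θ p| + ∑ i, |comp θ i p|)) := by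
    rw [hL, abs_mul, abs_of_pos (show 0 < 1 / (1 + α) by positivity)]
    gcongr
    refine (abs_add_le _ _).trans ?_
    rw [abs_neg]
    have := mul_nonneg hm0 (abs_nonneg (enth α θ p))
    nlinarith
  have hn' := (le_abs_self _).trans (hn () p hp hy)
  calc |Real.exp (1 / α * logJ θ p) - 1|
      ≤ |1 / α * logJ θ p| * (Real.exp (1 / α * logJ θ p) + 1) := abs_exp_sub_one_le _
    _ ≤ (1 / (1 + α) * ((1 + m) * (|enth α θ p| + ∑ i, |comp θ i p|))) * n := by gcongr
    _ = _ := by ring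

include hT hθ hV hJ hS hD in
/-- The production of energy is controlled by the energy on bounded sets. -/
lemma exists_production_bound (hα : 0 < α) (hsymm : ∀ τ i j, S τ i j = S τ j i) (y₀ : E3) (R : ℝ) :
    ∃ M, 0 ≤ M ∧ ∀ p : ℝ × E3, p.1 ∈ Ioo 0 T → p.2 ∈ Metric.closedBall y₀ R →
      (∀ i, ∑ j, S p.1 i j * slabD T dirT (comp V j) p + ∑ j, D p.1 i j * comp V j p
        + (Real.exp (-(1 / α * logJ θ p))
            * ∑ k, scrA (θ p.1) p.2 k i * slabD T (dirX k) (enth α θ) p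
          + (1 - Real.exp (-(1 / α * logJ θ p))) * (p.2 i + comp θ i p)) = 0) →
      slabD T dirT (energy α S θ V) p + ∑ k, slabD T (dirX k) (flux α θ V k) p
        ≤ M * sqSum α θ V p := by
  have hθ1 := fun i => (contDiffOn_comp hθ i).of_le (show (1 : WithTop ℕ∞) ≤ 2 by norm_num)
  have hLc := contDiffOn_logJ hT hθ hJ
  have hη : ∀ j, ContinuousOn (fun p : ℝ × E3 => p.2 j + comp θ j p) (slab T) := fun j =>
    ((contDiffOn_spaceCoord j).add (hθ1 j)).continuousOn
  obtain ⟨m₁, hm₁, h₁⟩ := exists_bound_slab_family (ι := Fin 3 × Fin 3)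
    (g := fun ij p => Real.exp (1 / α * logJ θ p) * (
          1 / α * slabD T dirT (logJ θ) p / 2 * S p.1 ij.1 ij.2
          + slabD T dirT (fun p => S p.1 ij.1 ij.2) p / 2 - D p.1 ij.1 ij.2)) (fun ij => by
      have hs := contDiffOn_fst_slab (hS ij.1 ij.2)
      have hd : ContinuousOn (fun p : ℝ × E3 => D p.1 ij.1 ij.2) (slab T) :=
        (hD ij.1 ij.2).comp continuousOn_fst fun _ hp => mem_slab.1 hp
      exact (contDiffOn_const.mul hLc).exp.continuousOn.mul
        (((((continuousOn_const.mul (continuousOn_slabD hT dirT hLc)).div_const 2).mul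
          hs.continuousOn).add ((continuousOn_slabD hT dirT hs).div_const 2)).sub hd)) y₀ R
  obtain ⟨m₂, hm₂, h₂⟩ := exists_bound_slab_family (ι := Fin 3)
    (g := fun j p => α / (1 + α) * (p.2 j + comp θ j p)
            + ∑ k, slabD T (dirX k) (fun p => scrA (θ p.1) p.2 k j) p) (fun j =>
      (continuousOn_const.mul (hη j)).add (continuousOn_finsetSum _ fun k _ =>
        continuousOn_slabD hT (dirX k) (contDiffOn_scrA hT hθ hJ k j))) y₀ R
  obtain ⟨m₃, hm₃, h₃⟩ := exists_bound_slab_family hη y₀ R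
  obtain ⟨m₄, hm₄, h₄⟩ := exists_temperature_bound hT hθ hJ hα y₀ R
  -- The numbers count products: 9 of velocities, 3 of $q$ with $V$, 3 of $\theta$ with $V$, and 12
  -- of one of $q,\theta_1,\theta_2,\theta_3$ with a velocity component.
  refine ⟨9 * m₁ + 3 * m₂ + 3 + 12 * m₄ * m₃, by positivity, fun p hp hy heq => ?_⟩
  have hmem : p ∈ slab T := mem_slab.2 (Ioo_subset_Icc_self hp)
  rw [energy_identity hT hθ hV hJ hS hα hsymm hp heq]
  set Q := sqSum α θ V p with hQ
  have hQ0 : 0 ≤ Q := sqSum_nonneg p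
  have hv : ∀ i, comp V i p ^ 2 ≤ Q := fun i => comp_velocity_sq_le i p
  have ht : ∀ i, comp θ i p ^ 2 ≤ Q := fun i => comp_sq_le i p
  have hq : enth α θ p ^ 2 ≤ Q := enth_sq_le p
  have b₁ := Finset.sum_le_sum fun i (_ : i ∈ Finset.univ) => Finset.sum_le_sum
    fun j (_ : j ∈ Finset.univ) => mul_mul_le_of_sq_le (hv i) (hv j) (h₁ (i, j) p hmem hy)
  have b₂ := Finset.sum_le_sum fun j (_ : j ∈ Finset.univ) =>
    mul_mul_le_of_sq_le hq (hv j) (h₂ j p hmem hy)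
  have b₃ : ∑ j, comp θ j p * comp V j p ≤ ∑ _j : Fin 3, Q :=
    Finset.sum_le_sum fun j (_ : j ∈ Finset.univ) => by
      have := abs_mul_le_of_sq_le (ht j) (hv j)
      rw [← abs_mul] at this
      exact (le_abs_self _).trans this
  have b₄ : |(Real.exp (1 / α * logJ θ p) - 1) * ∑ j, (p.2 j + comp θ j p) * comp V j p|
      ≤ 12 * m₄ * m₃ * Q := by
    have hs : |∑ j, (p.2 j + comp θ j p) * comp V j p| ≤ m₃ * ∑ j, |comp V j p| := by
      rw [Finset.mul_sum]
      refine (Finset.abs_sum_le_sum_abs _ _).trans (Finset.sum_le_sum fun i _ => ?_)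
      rw [abs_mul]
      exact mul_le_mul_of_nonneg_right (h₃ i p hmem hy) (abs_nonneg _)
    have hprod : (|enth α θ p| + ∑ i, |comp θ i p|) * ∑ j, |comp V j p| ≤ 12 * Q := by
      have e1 := fun j => abs_mul_le_of_sq_le hq (hv j)
      have e2 := fun i j => abs_mul_le_of_sq_le (ht i) (hv j)
      simp only [Fin.sum_univ_three]
      linarith [e1 0, e1 1, e1 2, e2 0 0, e2 0 1, e2 0 2, e2 1 0, e2 1 1, e2 1 2, e2 2 0, e2 2 1,
        e2 2 2]
    have hs0 : 0 ≤ ∑ i, |comp θ i p| := Finset.sum_nonneg fun i _ => abs_nonneg _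
    rw [abs_mul]
    calc |Real.exp (1 / α * logJ θ p) - 1| * |∑ j, (p.2 j + comp θ j p) * comp V j p|
        ≤ (m₄ * (|enth α θ p| + ∑ i, |comp θ i p|)) * (m₃ * ∑ j, |comp V j p|) := by
          gcongr
          exact h₄ p hmem hy
      _ = m₄ * m₃ * ((|enth α θ p| + ∑ i, |comp θ i p|) * ∑ j, |comp V j p|) := by ring
      _ ≤ m₄ * m₃ * (12 * Q) := by gcongr
      _ = _ := by ring
  have b₅ := neg_abs_le ((Real.exp (1 / α * logJ θ p) - 1) * ∑ j, (p.2 j + comp θ j p) * comp V j p)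
  simp only [Finset.sum_const, Finset.card_univ, Fintype.card_fin, nsmul_eq_mul,
    Nat.cast_ofNat] at b₁ b₂ b₃
  linarith

lemma slab_mono {T' : ℝ} (h : T' ≤ T) : slab T' ⊆ slab T :=
  prod_mono_left (Icc_subset_Icc_right h)

lemma slabD_restrict {T' : ℝ} (h : T' ≤ T) {g : ℝ × E3 → ℝ} (hg : ContDiffOn ℝ 1 g (slab T))
    {p : ℝ × E3} (hp : p.1 ∈ Ioo 0 T') (a : ℝ × E3) : slabD T' a g p = slabD T a g p :=
  slabD_eq_of_hasDerivAt (hg.mono (slab_mono h)) hp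
    (hasDerivAt_line hg (Ioo_subset_Ioo_right h hp) a)

include hT hθ in
-- The complement of the support is open, so $\theta(0,\cdot)$ vanishes near $y$. Hence $D\theta$
-- vanishes too, $\mathscr J=1$ and $q=0$.
lemma energy_initial_eq_zero (hθ₀ : tsupport (θ 0) ⊆ Metric.closedBall 0 1)
    (hV₀ : tsupport (V 0) ⊆ Metric.closedBall 0 1) {y : E3} (hy : 1 < ‖y‖) :
    energy α S θ V (0, y) = 0 := by
  have hnot : y ∉ Metric.closedBall (0 : E3) 1 := by
    rw [mem_closedBall_zero_iff]; exact not_le.2 hy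
  have hθy := notMem_tsupport_iff_eventuallyEq.1 fun h => hnot (hθ₀ h)
  have hVy := (notMem_tsupport_iff_eventuallyEq.1 fun h => hnot (hV₀ h)).self_of_nhds
  have hmem : ((0 : ℝ), y) ∈ slab T := mem_slab.2 (left_mem_Icc.2 hT.le)
  have h1 : ∀ i, comp θ i (0, y) = 0 := fun i => by
    have := hθy.self_of_nhds
    simp only [comp, this]
    rfl
  have h2 : ∀ i, comp V i (0, y) = 0 := fun i => by
    simp only [comp, hVy]
    rfl
  have h3 : Deta (θ 0) y = 1 := by
    ext i j
    have e1 := Deta_eq hθ hmem i j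
    rw [← jac_eq hθ hmem] at e1
    have e2 : (fun x => θ 0 x i) =ᶠ[nhds y] fun _ => 0 := by
      filter_upwards [hθy] with x hx
      rw [hx]; rfl
    have e3 : jac (θ 0) y i j = 0 := by
      simp only [jac, Matrix.of_apply, pderiv]
      rw [e2.fderiv_eq]
      simp
    rw [e1, e3, add_zero]
  have h4 : enth α θ (0, y) = 0 := by
    simp [enth, logJ, scrJ, h3, h1]
  simp [energy, h1, h2, h4]

end EnergyEstimate

end FiniteProp

/-! ### Conclusion: backward cones that avoid the unit ball -/

theorem theoremT (α σ : ℝ) (hα : 0 < α) (hσ : 0 < σ) (hσ' : σ < min (3 / α) 2)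
    (B : FiniteProp.AffineMotion α)
    (N : ℕ) (hN : 4 ≤ N)
    (lam : ℝ) (hlam : 0 < lam)
    (β : FiniteProp.E3 → ℝ) (hβ : ContDiff ℝ 1 β)
    (hβnorm : FiniteProp.sobolevSq (N + 1) β ≤ ENNReal.ofReal lam)
    (hβsupp : tsupport β ⊆ Metric.closedBall 0 1)
    (T : ℝ) (hT : 0 < T)
    (θ V : ℝ → FiniteProp.E3 → FiniteProp.E3)
    (hsol : FiniteProp.IsSolution B σ β T θ V)
    (hθ₀ : tsupport (θ 0) ⊆ Metric.closedBall 0 1)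
    (hV₀ : tsupport (V 0) ⊆ Metric.closedBall 0 1)
    (C : ℝ) (hapriori : FiniteProp.APriori B N σ C T θ V) :
    ∃ K : ℝ, 0 < K ∧ ∀ τ ∈ Set.Icc (0 : ℝ) T, ∀ y : FiniteProp.E3,
      1 + K * τ < ‖y‖ → θ τ y = 0 ∧ V τ y = 0 := by
  open FiniteProp in
  have hθ : ContDiffOn ℝ 2 (fun p : ℝ × E3 => θ p.1 p.2) (slab T) := hsol.contDiff
  have hV := hsol.velocity
  have hJ₀ : ∀ p ∈ slab T, 2 / 3 ≤ scrJ (θ p.1) p.2 := fun p hp => by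
    have := (abs_le.1 (abs_scrJ_sub_one_le hT hθ hapriori hp)).1
    linarith
  have hJ : ∀ p ∈ slab T, 0 < scrJ (θ p.1) p.2 := fun p hp =>
    lt_of_lt_of_le (by norm_num) (hJ₀ p hp)
  have hA : ∀ p ∈ slab T, ∀ i j, |scrA (θ p.1) p.2 i j| ≤ 4 / 3 := fun p hp =>
    abs_scrA_le hT hθ hapriori hJ hp
  obtain ⟨S, D, hS, hD, hsymm, ⟨c, hc, hcoer⟩, hSD⟩ := B.exists_symmetrizer σ T
  obtain ⟨c₀, hc₀, hE⟩ := energy_coercive (V := V) hα (by norm_num) hJ₀ hc hcoer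
  have he := contDiffOn_energy (α := α) hT hθ hV hJ hS
  have hf := contDiffOn_flux (α := α) hT hθ hV hJ
  have he0 : ∀ p ∈ slab T, 0 ≤ energy α S θ V p := fun p hp =>
    (mul_nonneg hc₀.le (sqSum_nonneg p)).trans (hE p hp)
  -- The flux constant is $9\cdot\frac43=12$, and dividing by the coercivity constant $c_0$
  -- expresses it through $e$. Neither depends on $y_0$.
  refine ⟨12 / c₀, by positivity, fun τ₀ hτ₀ y₀ hy₀ => ?_⟩
  have hmem : (τ₀, y₀) ∈ slab T := mem_slab.2 hτ₀
  have hK : 0 ≤ 12 / c₀ * τ₀ := mul_nonneg (by positivity) hτ₀.1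
  suffices h : energy α S θ V (τ₀, y₀) = 0 by
    have hQ : sqSum α θ V (τ₀, y₀) ≤ 0 := by
      have := hE _ hmem
      rw [h] at this
      exact nonpos_of_mul_nonpos_right this hc₀
    constructor
    · ext i
      exact pow_eq_zero_iff two_ne_zero |>.1
        (le_antisymm ((comp_sq_le i (τ₀, y₀)).trans hQ) (sq_nonneg _))
    · ext i
      exact pow_eq_zero_iff two_ne_zero |>.1
        (le_antisymm ((comp_velocity_sq_le i (τ₀, y₀)).trans hQ) (sq_nonneg _))
  -- The cone estimate needs an interval of positive length, so $\tau_0=0$ is read off from the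
  -- data.
  rcases hτ₀.1.eq_or_lt with h0 | h0
  · subst h0
    exact energy_initial_eq_zero hT hθ hθ₀ hV₀ (by linarith)
  -- The ball of radius $|y_0|-1$ about $y_0$ misses the closed unit ball, so on it $\beta$ and the
  -- data vanish. The assumption on $y_0$ says exactly that this radius exceeds $K\tau_0$.
  have hout : ∀ y ∈ Metric.ball y₀ (‖y₀‖ - 1), 1 < ‖y‖ := fun y hy => by
    rw [Metric.mem_ball, dist_eq_norm] at hy
    have := norm_sub_norm_le y₀ y
    rw [norm_sub_rev] at this
    linarith
  obtain ⟨M, hM, hprod⟩ :=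
    exists_production_bound hT hθ hV hJ hS hD hα hsymm y₀ (‖y₀‖ - 1)
  have hsub := slab_mono hτ₀.2
  -- The cone estimate speaks of the final time, hence the restriction to the slab up to $\tau_0$.
  -- The growth rate $M/c_0$ may depend on $y_0$, since it enters only through Grönwall with zero
  -- data.
  refine energy_eq_zero_on_cone (y₀ := y₀) (r := ‖y₀‖ - 1) (K := 12 / c₀) (M := M / c₀)
    (f := flux α θ V) h0 (by positivity) (he.mono hsub) (fun k => (hf k).mono hsub)
    (fun p hp => he0 p (hsub hp)) (fun p hp v => ?_)
    (fun y hy => energy_initial_eq_zero hT hθ hθ₀ hV₀ (hout y hy)) (fun τ hτ y hy => ?_)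
    (by linarith) (by simp; linarith)
  · refine (abs_sum_mul_flux_le (hA p (hsub hp)) v).trans ?_
    calc 9 * (4 / 3) * ‖v‖ * sqSum α θ V p = 12 / c₀ * ‖v‖ * (c₀ * sqSum α θ V p) := by
          field_simp; ring_nf
      _ ≤ 12 / c₀ * ‖v‖ * energy α S θ V p :=
          mul_le_mul_of_nonneg_left (hE p (hsub hp)) (by positivity)
  · have hτT : τ ∈ Set.Ioo 0 T := Set.Ioo_subset_Ioo_right hτ₀.2 hτ
    have heq := hSD τ (fun j => slabD T dirT (comp V j) (τ, y)) (fun j => comp V j (τ, y))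
      (fun j => Real.exp (-(1 / α * logJ θ (τ, y)))
            * ∑ k, scrA (θ τ) y k j * slabD T (dirX k) (enth α θ) (τ, y)
          + (1 - Real.exp (-(1 / α * logJ θ (τ, y)))) * (y j + comp θ j (τ, y)))
      (fun i => exterior_equation (p := (τ, y)) hT hsol hJ hβsupp hτT (hout y hy) i)
    have h1 := hprod (τ, y) hτT (Metric.ball_subset_closedBall hy) heq
    have h2 : fderivWithin ℝ (energy α S θ V) (slab τ₀) (τ, y) (1, 0)
        = slabD T dirT (energy α S θ V) (τ, y) := slabD_restrict hτ₀.2 he hτ dirT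
    have h3 : ∀ k, pderiv k (fun x => flux α θ V k (τ, x)) y
        = slabD T (dirX k) (flux α θ V k) (τ, y) := fun k =>
      pderiv_slice (hf k) (Set.Ioo_subset_Icc_self hτT) y k
    simp only [h2, h3]
    refine h1.trans ?_
    calc M * sqSum α θ V (τ, y) = M / c₀ * (c₀ * sqSum α θ V (τ, y)) := by field_simp
      _ ≤ M / c₀ * energy α S θ V (τ, y) :=
          mul_le_mul_of_nonneg_left (hE _ (mem_slab.2 (Set.Ioo_subset_Icc_self hτT)))
            (by positivity)
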